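/- **Setting.** Let $\Omega$ be a planar simply connected domain with punctures $\lambda_1,\dots,\lambda_n\in\Omega$, and let $\mathcal G$ be a triangulation of the sphere obtained by contracting $\partial\Omega$ to a point, with vertices $\lambda_1,\dots,\lambda_n,\partial\Omega$, finite set of edges $\mathcal E$ (arbitrarily oriented) and finite set of faces $\mathcal F$. Combinatorially, $\mathcal G$ is a connected gluing of oriented triangles along pairs of sides such that $|\mathrm{Vert}|-|\mathcal E|+|\mathcal F|=2$. A *lamination* $\Gamma$ is a finite collection of disjoint simple loops in $\Omega\setminus\{\lambda_1,\dots,\lambda_n\}$, none of them contractible, considered up to homotopy. It is given by its non-backtracking drawing on $\mathcal G$: numbers $\mathbf n(\Gamma)=(n_e)_{e\in\mathcal E}\in\mathbb Z_{\ge0}^{\mathcal E}$ of crossing points on the edges and, in each face, non-crossing chords matching all crossing points on its boundary, every chord joining two different sides of the face. Put $|\Gamma|=\sum_e n_e$ and $|\mathbf m|=\sum_e m_e$ for $\mathbf m\in\mathbb Z_{\ge 0}^{\mathcal E}$. For $\mathbf A=(A_e)\in \mathrm{SL}_2(\mathbb C)^{\mathcal E}$ let $$f_\Gamma(\mathbf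 A)=\prod_{\gamma\in\Gamma}\mathrm{Tr}\,\big(A_{e_0}^{\pm1}A_{e_1}^{\pm1}\cdots A_{e_{k-1}}^{\pm1}\big),$$ where $e_0,\dots,e_{k-1}$ are the edges successively crossed by the loop $\gamma$ and the sign is $+1$ for a crossing from left to right and $-1$ for a crossing from right to left. Let $V_d$ be the space of homogeneous polynomials of degree $d$ in $x,y$, with $\mathbb C^{2\times2}$ acting by $x\mapsto Ax$, $y\mapsto Ay$ (linear substitution) and with the bilinear form determined by $x^ky^{d-k}\wedge x^{d-k}y^{k}=(-1)^{d-k}\binom dk^{-1}$, all other pairings of monomials being $0$. For $\mathbf n\in\mathbb Z_{\ge0}^{\mathcal E}$ let $\mathbf V_{\mathbf n}=\bigotimes_{e\in\mathcal E}(V_{n_e}\otimes V_{n_e})$, where the two factors correspond to the left and to the right side of $e$. For $\mathbf v\in\mathbf V_{\mathbf n}$ let $\Upsilon(\mathbf v)$ be the polynomial on $(\mathbb C^{2\times2})^{\mathcal E}$ given, linearly in $\mathbf v$, by $\Upsilon\big(\bigotimes_e(v_e\otimes w_e)\big)(\mathbf A)=\prod_e (v_e\wedge A_ew_e)$. By the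 Peter–Weyl theorem, restriction to $\mathrm{SL}_2(\mathbb C)^{\mathcal E}$ makes $\Upsilon$ an isomorphism of $\bigoplus_{\mathbf n}\mathbf V_{\mathbf n}$ onto the algebraic functions on $\mathrm{SL}_2(\mathbb C)^{\mathcal E}$. Let $\mathbf v_\Gamma\in \mathbf V_{\mathbf n(\Gamma)}$ be the $\mathbf n(\Gamma)$-component of the preimage of $f_\Gamma$, and define on $(\mathbb C^{2\times2})^{\mathcal E}$ $$G_\Gamma=\Upsilon(\mathbf v_\Gamma),\qquad G_{\Gamma,\mathbf m}(\mathbf A)=G_\Gamma(\mathbf A)\prod_{e\in\mathcal E}(\det A_e)^{m_e}.$$ For $R>0$ let $\mathbb B_R=\{\mathbf A\in(\mathbb C^{2\times2})^{\mathcal E}:\ \mathrm{Tr}\,A_eA_e^*<R^2\ \text{for all } e\in\mathcal E\}$, and let $L^2(\mathbb B_R)$ be taken with respect to the Lebesgue measure on $(\mathbb C^{2\times 2})^{\mathcal E}\simeq\mathbb C^{4|\mathcal E|}$. **Proposition.** There exists an absolute constant $\eta_0>0$, independent of the triangulation $\mathcal G$ and of the number of punctures, such that for all triangulations $\mathcal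 G$ as above, all laminations $\Gamma$, all $\mathbf m\in\mathbb Z_{\ge0}^{\mathcal E}$ and all $R>0$, $$\|G_{\Gamma,\mathbf m}\|_{L^2(\mathbb B_R)}\ \ge\ (\eta_0R)^{|\Gamma|+2|\mathbf m|+4|\mathcal E|}.$$ -/

import Mathlib

open scoped Matrix

noncomputable section

namespace PeterWeyl

/-!
## Triangulations

A triangulation of the punctured domain is given by oriented triangles whose sides are glued in
pairs.  The three sides of a face `σ` are `(σ, 0), (σ, 1), (σ, 2)` in counterclockwise order.  Every
edge `e` is oriented and has two sides: `(e, true)`, contained in the face to the left of `e`, and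
`(e, false)`, contained in the face to the right of `e`.
-/

/-- Oriented triangles (indexed by `F`) glued along oriented edges (indexed by `E`). -/
structure Gluing (E F : Type) where
  side : E × Bool ≃ F × Fin 3

namespace Gluing

variable {E F : Type} (T : Gluing E F)

/-- The face adjacent to a side of an edge. -/
def face (p : E × Bool) : F := (T.side p).1

/-- The other side of the same edge. -/
def opp : Equiv.Perm (E × Bool) where
  toFun p := (p.1, !p.2)
  invFun p := (p.1, !p.2)
  left_inv p := by simp
  right_inv p := by simp

/-- The counterclockwise successor of a side on the boundary of its face. -/
def next : Equiv.Perm (E × Bool) :=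
  (T.side.trans ((Equiv.refl F).prodCongr (Equiv.addRight (1 : Fin 3)))).trans T.side.symm

/-- If every side is directed counterclockwise along its face, then `p` and `next (opp p)` start at
the same vertex; all sides starting at a vertex form one cycle of this permutation. -/
def turn : Equiv.Perm (E × Bool) := opp.trans T.next

/-- The vertices of the glued surface. -/
def Vertex : Type := Quotient (Equiv.Perm.SameCycle.setoid T.turn)

end Gluing

/-- A triangulation, with oriented edges `E` and faces `F`, of a simply connected planar domain
whose boundary is contracted to a point: a connected gluing of triangles that is a sphere.
One vertex stands for the boundary `∂Ω`, the other vertices are the punctures `λ₁, …, λₙ`. -/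
structure Triangulation (E F : Type) [Fintype E] [Fintype F] extends Gluing E F where
  connected : ∀ σ τ : F, Relation.ReflTransGen
    (fun a b => ∃ p : E × Bool, toGluing.face p = a ∧ toGluing.face (Gluing.opp p) = b) σ τ
  euler : (Nat.card toGluing.Vertex : ℤ) - Fintype.card E + Fintype.card F = 2
  boundaryVertex : toGluing.Vertex

/-!
## Laminations
-/

/-- The points `(e, b, k)`: the `k`-th crossing point on the edge `e` (counted from the beginning of
`e`), approached from the side `b` of `e`. -/
abbrev Point {E : Type} (n : E → ℕ) : Type := Σ p : E × Bool, Fin (n p.1)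

/-- The position of a point on its side, counted counterclockwise along the boundary of the face
containing this side. -/
def Point.pos {E : Type} {n : E → ℕ} (s : Point n) : ℕ :=
  if s.1.2 then (s.2 : ℕ) else n s.1.1 - 1 - s.2

/-- The points `s`, `t` belong to the boundary of the same face and `s` precedes `t` when this
boundary is traversed counterclockwise, starting with the side number `0`. -/
def Point.Before {E F : Type} (T : Gluing E F) {n : E → ℕ} (s t : Point n) : Prop :=
  T.face s.1 = T.face t.1 ∧
    ((T.side s.1).2 < (T.side t.1).2 ∨ (T.side s.1).2 = (T.side t.1).2 ∧ s.pos < t.pos)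

/-- A lamination, i.e. a finite collection of disjoint simple loops avoiding the punctures and
considered up to homotopy, drawn without backtracking with respect to the triangulation: it crosses
each edge `e` at `num e` points, and these points are connected inside each face by disjoint
chords, every chord connecting two different sides of the face. -/
structure Lamination {E F : Type} (T : Gluing E F) where
  /-- The number `n_e` of crossings with the edge `e`. -/
  num : E → ℕ
  /-- The other endpoint of the chord starting at a given point. -/
  chord : Equiv.Perm (Point num)
  chord_chord : ∀ s, chord (chord s) = s
  chord_face : ∀ s, T.face (chord s).1 = T.face s.1
  chord_side : ∀ s, (chord s).1 ≠ s.1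
  noncrossing : ∀ s t, ¬ (Point.Before T s t ∧ Point.Before T t (chord s) ∧
    Point.Before T (chord s) (chord t))

namespace Lamination

variable {E F : Type} {T : Gluing E F} (Γ : Lamination T)

/-- The complexity `|Γ|`. -/
def complexity [Fintype E] : ℕ := ∑ e, Γ.num e

/-- Crossing an edge: the same crossing point seen from the other side. -/
def cross : Equiv.Perm (Point Γ.num) where
  toFun s := ⟨Gluing.opp s.1, s.2⟩
  invFun s := ⟨Gluing.opp s.1, s.2⟩
  left_inv s := by
    rcases s with ⟨⟨e, b⟩, k⟩
    cases b <;> rfl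
  right_inv s := by
    rcases s with ⟨⟨e, b⟩, k⟩
    cases b <;> rfl

/-- Moving along a loop: from a point `s`, about to cross its edge, cross this edge and
follow the chord to the point at which the next edge is about to be crossed. -/
def step : Equiv.Perm (Point Γ.num) := Γ.cross.trans Γ.chord

/-- The loops `γ ∈ Γ`: the classes of points connected by chords and crossings. -/
def Loop : Type :=
  MulAction.orbitRel.Quotient
    (Subgroup.closure ({Γ.cross, Γ.chord} : Set (Equiv.Perm (Point Γ.num)))) (Point Γ.num)

/-- The factor of the holonomy that corresponds to crossing the edge of `s` starting on the side of
`s`: it is `A_e` when crossing from left to right and `A_e⁻¹` when crossing from right to left. -/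
def crossingMatrix (A : E → Matrix.SpecialLinearGroup (Fin 2) ℂ) (s : Point Γ.num) :
    Matrix.SpecialLinearGroup (Fin 2) ℂ :=
  if s.1.2 then A s.1.1 else (A s.1.1)⁻¹

/-- The holonomy `A_{e₀}^{±1} A_{e₁}^{±1} ⋯ A_{e_{m-1}}^{±1}` along the loop started at `s`. -/
def hol (A : E → Matrix.SpecialLinearGroup (Fin 2) ℂ) (s : Point Γ.num) :
    Matrix.SpecialLinearGroup (Fin 2) ℂ :=
  ((List.range (Function.minimalPeriod Γ.step s)).map
    (fun i => Γ.crossingMatrix A (Γ.step^[i] s))).prod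

/-- The function `f_Γ = ∏_{γ ∈ Γ} Tr hol(A, γ)`; the trace does not depend on the starting point
and on the orientation of a loop, so they are chosen arbitrarily. -/
def f (A : E → Matrix.SpecialLinearGroup (Fin 2) ℂ) : ℂ :=
  ∏ᶠ γ : Γ.Loop, Matrix.trace (Γ.hol A (Quotient.out γ) : Matrix (Fin 2) (Fin 2) ℂ)

end Lamination

/-!
## The Peter–Weyl decomposition

The irreducible representation `V_n` of `SL₂(ℂ)` is the space of homogeneous polynomials of degree
`n` in two variables `x`, `y`.  The tensor product `𝐕_𝐧` of two copies of `V_{n_e}` per edge `e` (one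
for each of the two sides of `e`) is the space of polynomials in the variables `x_p`, `y_p`
(`p` runs over the sides of edges) that are homogeneous of degree `n_e` in `x_p`, `y_p` for each
of the two sides `p` of each edge `e`.
-/

section Representations

variable (E : Type)

/-- The variables: `(p, 0)` stands for `x_p` and `(p, 1)` stands for `y_p`. -/
abbrev Var : Type := (E × Bool) × Fin 2

variable {E} [DecidableEq E]

/-- The multi-degree of a variable, one component for each side of an edge. -/
def multidegree (v : Var E) : E × Bool → ℕ := Pi.single v.1 1

/-- The space `𝐕_𝐧 = ⨂_e (V_{n_e} ⊗ V_{n_e})`. -/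
abbrev V (n : E → ℕ) : Submodule ℂ (MvPolynomial (Var E) ℂ) :=
  MvPolynomial.weightedHomogeneousSubmodule ℂ multidegree (fun p => n p.1)

/-- The pairing `x^k y^l ∧ x^k' y^l'` on `V_n`, `n = k + l = k' + l'`, induced by the form
`x ∧ y = 1` on `V_1`: it is `(-1)^l / binom(n, k)` if `k' = l` and `l' = k`, and zero otherwise. -/
def wedge (k l k' l' : ℕ) : ℂ :=
  if k' = l ∧ l' = k then (-1) ^ l / (Nat.choose (k + l) k : ℂ) else 0

/-- The linear functional `Λ`: for each edge, pair the vectors standing at its two sides. -/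
def Lam [Fintype E] : MvPolynomial (Var E) ℂ →ₗ[ℂ] ℂ :=
  (MvPolynomial.basisMonomials (Var E) ℂ).constr ℂ (fun d => ∏ e : E,
    wedge (d ((e, true), 0)) (d ((e, true), 1)) (d ((e, false), 0)) (d ((e, false), 1)))

/-- The action `𝐯 ↦ 𝐀[𝐯]` of `(ℂ^{2×2})^E`: the matrix `A_e` acts on the factor standing at the
right side of `e`, by `x ↦ A_e x`, `y ↦ A_e y`. -/
def act (A : E → Matrix (Fin 2) (Fin 2) ℂ) :
    MvPolynomial (Var E) ℂ →ₐ[ℂ] MvPolynomial (Var E) ℂ :=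
  MvPolynomial.aeval (fun v : Var E =>
    if v.1.2 then MvPolynomial.X v
    else ∑ j : Fin 2, MvPolynomial.C (A v.1.1 j v.2) * MvPolynomial.X (v.1, j))

/-- The polynomial function `𝐀 ↦ Λ(𝐀[𝐯])` on `(ℂ^{2×2})^E`. -/
def UpsilonExt [Fintype E] :
    MvPolynomial (Var E) ℂ →ₗ[ℂ] ((E → Matrix (Fin 2) (Fin 2) ℂ) → ℂ) :=
  LinearMap.pi (fun A => Lam ∘ₗ (act A).toLinearMap)

/-- The Peter–Weyl isomorphism `Υ` between `⨁_𝐧 𝐕_𝐧` and the algebraic functions on `SL₂(ℂ)^E`: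
the restriction of `𝐀 ↦ Λ(𝐀[𝐯])` to `SL₂(ℂ)^E`. -/
def Upsilon [Fintype E] :
    (DirectSum (E → ℕ) (fun n => V n)) →ₗ[ℂ]
      ((E → Matrix.SpecialLinearGroup (Fin 2) ℂ) → ℂ) :=
  DirectSum.toModule ℂ (E → ℕ) _ (fun n =>
    (LinearMap.funLeft ℂ ℂ (fun (A : E → Matrix.SpecialLinearGroup (Fin 2) ℂ) (e : E) =>
      (A e : Matrix (Fin 2) (Fin 2) ℂ))) ∘ₗ UpsilonExt ∘ₗ (V n).subtype)

/-- The component in `𝐕_𝐧` of an algebraic function on `SL₂(ℂ)^E` under the isomorphism `Υ`. -/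
def peterWeylComponent [Fintype E] (f : (E → Matrix.SpecialLinearGroup (Fin 2) ℂ) → ℂ)
    (n : E → ℕ) : V n :=
  Function.invFun Upsilon f n

end Representations

namespace Lamination

variable {E F : Type} [Fintype E] [DecidableEq E] {T : Gluing E F} (Γ : Lamination T)

/-- The polynomial `G_Γ` on `(ℂ^{2×2})^E` that extends the Peter–Weyl basis function `g_Γ`, the
projection of `f_Γ` onto the component `𝐕_{𝐧(Γ)}`. -/
def G (A : E → Matrix (Fin 2) (Fin 2) ℂ) : ℂ :=
  UpsilonExt (peterWeylComponent Γ.f Γ.num : MvPolynomial (Var E) ℂ) A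

/-- `G_{Γ,𝐦}(𝐀) = G_Γ(𝐀) ∏_e (det A_e)^{m_e}`. -/
def Gm (m : E → ℕ) (A : E → Matrix (Fin 2) (Fin 2) ℂ) : ℂ :=
  Γ.G A * ∏ e, (A e).det ^ m e

end Lamination

/-- The poly-ball `𝔹_R`: all `(A_e)` with `Tr A_e A_e^* < R²` for every `e`. -/
def polyBall (E : Type) (R : ℝ) : Set (E → Fin 2 → Fin 2 → ℂ) :=
  {a | ∀ e, (Matrix.trace (Matrix.of (a e) * (Matrix.of (a e))ᴴ)).re < R ^ 2}

/-- The norm in `L²(𝔹_R)` with respect to the Lebesgue measure on `(ℂ^{2×2})^E ≃ ℂ^{4|E|}`. -/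
def polyBallNorm {E : Type} [Fintype E] (R : ℝ) (g : (E → Matrix (Fin 2) (Fin 2) ℂ) → ℂ) : ℝ :=
  Real.sqrt (∫ a in polyBall E R, ‖g (fun e => Matrix.of (a e))‖ ^ 2)

end PeterWeyl

end

/-!
The function `f_Γ` extends to a polynomial in arbitrary matrices when inverses are replaced by
adjugates (`Lamination.fExt`). The idea is to look at rank one matrices, where everything factorizes
and no cancellation occurs. Put a vector `z_p ∈ ℂ²` at every side `p` of every edge and let `A_e` be
the rank one matrix built from the two vectors at the sides of `e` (`rankOne`). Then

* `Υ(𝐯)` takes the value `𝐯(z)` at these matrices (`UpsilonExt_rankOne`);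
* a trace of a product of rank one matrices is a product of scalar products of consecutive factors,
  so `fExt` is, up to a sign, the product over all chords of `Γ` of the determinants of the two
  vectors standing at the sides joined by the chord (`Lamination.fExt_rankOne`).

Since matrices of determinant one can tend to infinity in the direction of any rank one matrices,
the values of a homogeneous extension at rank one matrices determine the Peter–Weyl component of
top degree (`component_eq_of_eval_rankOne`). Hence `𝐯_Γ` is, up to a sign, just the product of these
determinants (`Lamination.peterWeylComponent_f`). That `f_Γ` lies in the image of `Υ` at all, so that
its preimage is meaningful, follows from an explicit Clebsch–Gordan identity for the product of
a matrix entry and a matrix coefficient (`exists_entry_mul_symCoeff`).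

A chord joins two different sides of a face. Placing vectors close to multiples of `(1, 0)`,
`(1, 1)`, `(1, 2)` at the three sides of every face therefore makes all determinants bounded below,
which bounds `|G_Γ|` below on rank one matrices (`Lamination.le_norm_G_rankOne`). To pass to
`G_{Γ,𝐦}`, which vanishes there when `𝐦 ≠ 0`, rotate the upper right entry of each `A_e` around
the value for which `A_e` has rank one. These rotations preserve the volume and `|det A_e|`, and the
mean value property of the polynomial `G_Γ`, taken over roots of unity, shows that the average of
`|G_Γ|²` over the rotations is at least its value at the center
(`Lamination.le_sum_norm_sq_Gm_rotate`). Integrating over a product of regions of matrices close to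
such rank one matrices, with volume and determinants bounded below, gives the claim.
-/

namespace PeterWeyl

/-! ### Matrix coefficients of symmetric powers -/

section SymCoeff

variable {R : Type*} [CommRing R]

/-- The coefficient of `x ^ j y ^ (k + l - j)` in `(A x) ^ k (A y) ^ l`, where `A` acts by linear
substitution; it is read off after setting `y = 1`. -/
noncomputable def symCoeff (M : Matrix (Fin 2) (Fin 2) R) (k l j : ℕ) : R :=
  ((Polynomial.C (M 0 0) * Polynomial.X + Polynomial.C (M 1 0)) ^ k *
    (Polynomial.C (M 0 1) * Polynomial.X + Polynomial.C (M 1 1)) ^ l).coeff j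

theorem symCoeff_map {S : Type*} [CommRing S] (φ : R →+* S) (M : Matrix (Fin 2) (Fin 2) R)
    (k l j : ℕ) : symCoeff (M.map φ) k l j = φ (symCoeff M k l j) := by
  rw [symCoeff, symCoeff, ← Polynomial.coeff_map]
  simp

/-- The homogeneous form of the expansion that defines `symCoeff`. -/
theorem linear_pow_mul_linear_pow {S : Type*} [CommRing S] [Algebra R S]
    (M : Matrix (Fin 2) (Fin 2) R) (k l : ℕ) (x y : S) :
    (algebraMap R S (M 0 0) * x + algebraMap R S (M 1 0) * y) ^ k *
        (algebraMap R S (M 0 1) * x + algebraMap R S (M 1 1) * y) ^ l =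
      ∑ j ∈ Finset.range (k + l + 1),
        algebraMap R S (symCoeff M k l j) * (x ^ j * y ^ (k + l - j)) := by
  have hdeg (a b : R) : (Polynomial.C a * Polynomial.X + Polynomial.C b).natDegree ≤ 1 :=
    Polynomial.natDegree_linear_le
  have hlin (a b : R) : Polynomial.homogenize (Polynomial.C a * Polynomial.X + Polynomial.C b) 1 =
      MvPolynomial.C a * MvPolynomial.X 0 + MvPolynomial.C b * MvPolynomial.X 1 := by
    simp [Polynomial.homogenize_add, Polynomial.homogenize_C_mul]
  have hpow (a b : R) (n : ℕ) :
      Polynomial.homogenize ((Polynomial.C a * Polynomial.X + Polynomial.C b) ^ n) n =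
      (MvPolynomial.C a * MvPolynomial.X 0 + MvPolynomial.C b * MvPolynomial.X 1) ^ n := by
    induction n with
    | zero => simp
    | succ n ih =>
      rw [pow_succ, Polynomial.homogenize_mul _ _ _ (hdeg a b), ih, hlin, pow_succ]
      exact (Polynomial.natDegree_pow_le_of_le n (hdeg a b)).trans (by simp)
  have h := Polynomial.homogenize_mul
    ((Polynomial.C (M 0 0) * Polynomial.X + Polynomial.C (M 1 0)) ^ k)
    ((Polynomial.C (M 0 1) * Polynomial.X + Polynomial.C (M 1 1)) ^ l) (m := k) (n := l)
    ((Polynomial.natDegree_pow_le_of_le k (hdeg _ _)).trans (by simp))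
    ((Polynomial.natDegree_pow_le_of_le l (hdeg _ _)).trans (by simp))
  rw [hpow, hpow] at h
  have h2 := congrArg (MvPolynomial.aeval ![x, y]) h
  simp only [map_mul, map_pow, map_add, MvPolynomial.aeval_X, MvPolynomial.aeval_C,
    Matrix.cons_val_zero, Matrix.cons_val_one] at h2
  rw [← h2, Polynomial.homogenize, map_sum, Finset.Nat.sum_antidiagonal_eq_sum_range_succ_mk]
  refine Finset.sum_congr rfl fun j _ => ?_
  rw [MvPolynomial.aeval_monomial]
  rw [Finsupp.prod_fintype _ _ (by simp)]
  simp [symCoeff]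

/-- This follows from the derivative of `p ^ (k + 1) q ^ l` for `p = a X + c`, `q = b X + d`, and from
`a q - b p = det M`. -/
theorem entry00_mul_symCoeff (M : Matrix (Fin 2) (Fin 2) R) (k l j : ℕ) :
    ((k + l + 1 : ℕ) : R) * (M 0 0 * symCoeff M k l j) =
      ((j + 1 : ℕ) : R) * symCoeff M (k + 1) l (j + 1) +
        (l : R) * (M.det * symCoeff M k (l - 1) j) := by
  have key : Polynomial.C (((k + l + 1 : ℕ) : R) * M 0 0) *
      ((Polynomial.C (M 0 0) * Polynomial.X + Polynomial.C (M 1 0)) ^ k *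
        (Polynomial.C (M 0 1) * Polynomial.X + Polynomial.C (M 1 1)) ^ l) =
      Polynomial.derivative
        ((Polynomial.C (M 0 0) * Polynomial.X + Polynomial.C (M 1 0)) ^ (k + 1) *
        (Polynomial.C (M 0 1) * Polynomial.X + Polynomial.C (M 1 1)) ^ l) +
      Polynomial.C ((l : R) * M.det) *
      ((Polynomial.C (M 0 0) * Polynomial.X + Polynomial.C (M 1 0)) ^ k *
        (Polynomial.C (M 0 1) * Polynomial.X + Polynomial.C (M 1 1)) ^ (l - 1)) := by
    rw [Matrix.det_fin_two]
    rcases l with _ | l <;> simp [Polynomial.derivative_pow] <;> ring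
  have h := congrArg (fun p => Polynomial.coeff p j) key
  simp only [Polynomial.coeff_add, Polynomial.coeff_C_mul, Polynomial.coeff_derivative] at h
  simp only [symCoeff, ← mul_assoc]
  rw [h]
  push_cast
  ring

theorem entry01_mul_symCoeff (M : Matrix (Fin 2) (Fin 2) R) (k l j : ℕ) :
    ((k + l + 1 : ℕ) : R) * (M 0 1 * symCoeff M k l j) =
      ((j + 1 : ℕ) : R) * symCoeff M k (l + 1) (j + 1) -
        (k : R) * (M.det * symCoeff M (k - 1) l j) := by
  have key : Polynomial.C (((k + l + 1 : ℕ) : R) * M 0 1) *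
      ((Polynomial.C (M 0 0) * Polynomial.X + Polynomial.C (M 1 0)) ^ k *
        (Polynomial.C (M 0 1) * Polynomial.X + Polynomial.C (M 1 1)) ^ l) =
      Polynomial.derivative
        ((Polynomial.C (M 0 0) * Polynomial.X + Polynomial.C (M 1 0)) ^ k *
        (Polynomial.C (M 0 1) * Polynomial.X + Polynomial.C (M 1 1)) ^ (l + 1)) -
      Polynomial.C ((k : R) * M.det) *
      ((Polynomial.C (M 0 0) * Polynomial.X + Polynomial.C (M 1 0)) ^ (k - 1) *
        (Polynomial.C (M 0 1) * Polynomial.X + Polynomial.C (M 1 1)) ^ l) := by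
    rw [Matrix.det_fin_two]
    rcases k with _ | k <;> simp [Polynomial.derivative_pow] <;> ring
  have h := congrArg (fun p => Polynomial.coeff p j) key
  simp only [Polynomial.coeff_sub, Polynomial.coeff_C_mul, Polynomial.coeff_derivative] at h
  simp only [symCoeff, ← mul_assoc]
  rw [h]
  push_cast
  ring

theorem symCoeff_succ_left_zero (M : Matrix (Fin 2) (Fin 2) R) (k l : ℕ) :
    symCoeff M (k + 1) l 0 = M 1 0 * symCoeff M k l 0 := by
  simp [symCoeff, Polynomial.mul_coeff_zero, pow_succ]; ring

theorem symCoeff_succ_left_succ (M : Matrix (Fin 2) (Fin 2) R) (k l j : ℕ) :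
    symCoeff M (k + 1) l (j + 1) = M 0 0 * symCoeff M k l j + M 1 0 * symCoeff M k l (j + 1) := by
  rw [symCoeff, pow_succ', mul_assoc, add_mul, Polynomial.coeff_add, mul_assoc,
    Polynomial.coeff_C_mul, Polynomial.coeff_X_mul, Polynomial.coeff_C_mul]
  rfl

theorem symCoeff_succ_right_zero (M : Matrix (Fin 2) (Fin 2) R) (k l : ℕ) :
    symCoeff M k (l + 1) 0 = M 1 1 * symCoeff M k l 0 := by
  simp [symCoeff, Polynomial.mul_coeff_zero, pow_succ]; ring

theorem symCoeff_succ_right_succ (M : Matrix (Fin 2) (Fin 2) R) (k l j : ℕ) :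
    symCoeff M k (l + 1) (j + 1) = M 0 1 * symCoeff M k l j + M 1 1 * symCoeff M k l (j + 1) := by
  rw [symCoeff, pow_succ', mul_left_comm, add_mul, Polynomial.coeff_add, mul_assoc,
    Polynomial.coeff_C_mul, Polynomial.coeff_X_mul, Polynomial.coeff_C_mul]
  rfl

theorem symCoeff_eq_zero (M : Matrix (Fin 2) (Fin 2) R) {k l j : ℕ} (h : k + l < j) :
    symCoeff M k l j = 0 := by
  apply Polynomial.coeff_eq_zero_of_natDegree_lt
  refine lt_of_le_of_lt (Polynomial.natDegree_mul_le.trans (add_le_add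
    (Polynomial.natDegree_pow_le_of_le k Polynomial.natDegree_linear_le)
    (Polynomial.natDegree_pow_le_of_le l Polynomial.natDegree_linear_le))) (by simpa using h)

/-- On rank one matrices `u wᵀ` the matrix coefficients of symmetric powers are monomials. -/
theorem symCoeff_vecMulVec (u w : Fin 2 → R) (k l j : ℕ) :
    symCoeff (Matrix.vecMulVec u w) k l j =
      w 0 ^ k * w 1 ^ l * (u 0 ^ j * u 1 ^ (k + l - j) * ((k + l).choose j : R)) := by
  have h (a : R) : Polynomial.C (u 0 * a) * Polynomial.X + Polynomial.C (u 1 * a) =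
      Polynomial.C a * (Polynomial.C (u 0) * Polynomial.X + Polynomial.C (u 1)) := by
    simp; ring
  simp only [symCoeff, Matrix.vecMulVec_apply, h, mul_pow, ← Polynomial.C_pow]
  rw [mul_mul_mul_comm, ← Polynomial.C_mul, Polynomial.coeff_C_mul, ← pow_add]
  congr 1
  rw [add_pow, Polynomial.finsetSum_coeff, Finset.sum_eq_single j]
  · rw [mul_pow, ← Polynomial.C_pow, ← Polynomial.C_pow, ← Polynomial.C_eq_natCast, mul_assoc,
      mul_assoc, ← Polynomial.C_mul, Polynomial.coeff_C_mul, Polynomial.coeff_X_pow_mul']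
    simp [mul_assoc, Polynomial.coeff_zero_eq_eval_zero]
  · intro i _ hij
    rw [mul_pow, ← Polynomial.C_pow, ← Polynomial.C_pow, ← Polynomial.C_eq_natCast, mul_assoc,
      mul_assoc, ← Polynomial.C_mul, Polynomial.coeff_C_mul, Polynomial.coeff_X_pow_mul',
      Polynomial.coeff_C]
    split_ifs <;> first | simp | omega
  · intro hj
    have hj : (k + l).choose j = 0 := Nat.choose_eq_zero_of_lt (by simpa using hj)
    simp [hj]

theorem symCoeff_smul (c : R) (M : Matrix (Fin 2) (Fin 2) R) (k l j : ℕ) :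
    symCoeff (c • M) k l j = c ^ (k + l) * symCoeff M k l j := by
  have h (a b : R) : Polynomial.C (c * a) * Polynomial.X + Polynomial.C (c * b) =
      Polynomial.C c * (Polynomial.C a * Polynomial.X + Polynomial.C b) := by
    simp; ring
  simp only [symCoeff, Matrix.smul_apply, smul_eq_mul, h, mul_pow, ← Polynomial.C_pow]
  rw [mul_mul_mul_comm, ← Polynomial.C_mul, Polynomial.coeff_C_mul, ← pow_add]

end SymCoeff

/-! ### The map `Υ` on monomials -/

section Monomials

variable {E : Type} [Fintype E]

theorem Lam_monomial (d : Var E →₀ ℕ) (c : ℂ) :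
    Lam (MvPolynomial.monomial d c) = c * ∏ e : E,
      wedge (d ((e, true), 0)) (d ((e, true), 1)) (d ((e, false), 0)) (d ((e, false), 1)) := by
  have h : (MvPolynomial.monomial d c : MvPolynomial (Var E) ℂ) =
      c • MvPolynomial.basisMonomials (Var E) ℂ d := by
    simp [MvPolynomial.smul_monomial]
  rw [h, map_smul, Lam, Module.Basis.constr_basis, smul_eq_mul]

theorem act_monomial (A : E → Matrix (Fin 2) (Fin 2) ℂ) (d : Var E →₀ ℕ) :
    act A (MvPolynomial.monomial d 1) = ∏ e : E,
      (MvPolynomial.X ((e, true), 0) ^ d ((e, true), 0) *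
        MvPolynomial.X ((e, true), 1) ^ d ((e, true), 1)) *
      ∑ j ∈ Finset.range (d ((e, false), 0) + d ((e, false), 1) + 1),
        MvPolynomial.C (symCoeff (A e) (d ((e, false), 0)) (d ((e, false), 1)) j) *
          (MvPolynomial.X ((e, false), 0) ^ j *
            MvPolynomial.X ((e, false), 1) ^ (d ((e, false), 0) + d ((e, false), 1) - j)) := by
  rw [act, MvPolynomial.aeval_monomial, Finsupp.prod_fintype _ _ (by simp), map_one, one_mul,
    Fintype.prod_prod_type, Fintype.prod_prod_type]
  refine Finset.prod_congr rfl fun e _ => ?_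
  have h := linear_pow_mul_linear_pow (A e) (d ((e, false), 0)) (d ((e, false), 1))
    (MvPolynomial.X ((e, false), 0) : MvPolynomial (Var E) ℂ) (MvPolynomial.X ((e, false), 1))
  simp only [MvPolynomial.algebraMap_eq] at h
  rw [← h, Fintype.prod_bool]
  simp [Fin.sum_univ_two]

/-- `Υ` factorizes over the edges on monomials. -/
theorem UpsilonExt_monomial (A : E → Matrix (Fin 2) (Fin 2) ℂ) (d : Var E →₀ ℕ) :
    UpsilonExt (MvPolynomial.monomial d 1) A = ∏ e : E,
      ∑ j ∈ Finset.range (d ((e, false), 0) + d ((e, false), 1) + 1),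
        symCoeff (A e) (d ((e, false), 0)) (d ((e, false), 1)) j *
          wedge (d ((e, true), 0)) (d ((e, true), 1)) j
            (d ((e, false), 0) + d ((e, false), 1) - j) := by
  classical
  change Lam (act A _) = _
  have hmon (f : E → ℕ × ℕ × ℕ × ℕ) (c : E → ℂ) :
      Lam (∏ e : E, (MvPolynomial.X ((e, true), 0) ^ (f e).1 *
        MvPolynomial.X ((e, true), 1) ^ (f e).2.1) * (MvPolynomial.C (c e) *
          (MvPolynomial.X ((e, false), 0) ^ (f e).2.2.1 *
            MvPolynomial.X ((e, false), 1) ^ (f e).2.2.2))) =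
      ∏ e, c e * wedge (f e).1 (f e).2.1 (f e).2.2.1 (f e).2.2.2 := by
    let D : Var E →₀ ℕ := Finsupp.equivFunOnFinite.symm fun v =>
      if v.1.2 then (if v.2 = 0 then (f v.1.1).1 else (f v.1.1).2.1)
      else (if v.2 = 0 then (f v.1.1).2.2.1 else (f v.1.1).2.2.2)
    have hD : MvPolynomial.monomial D (∏ e, c e) =
        ∏ e : E, (MvPolynomial.X ((e, true), 0) ^ (f e).1 *
        MvPolynomial.X ((e, true), 1) ^ (f e).2.1) * (MvPolynomial.C (c e) *
          (MvPolynomial.X ((e, false), 0) ^ (f e).2.2.1 *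
            MvPolynomial.X ((e, false), 1) ^ (f e).2.2.2)) := by
      rw [MvPolynomial.monomial_eq, Finsupp.prod_fintype _ _ (by simp), map_prod,
        Fintype.prod_prod_type, Fintype.prod_prod_type, ← Finset.prod_mul_distrib]
      refine Finset.prod_congr rfl fun e _ => ?_
      simp only [Fintype.prod_bool, Fin.prod_univ_two]
      simp [D]
      ring
    rw [← hD, Lam_monomial, ← Finset.prod_mul_distrib]
    simp [D]
  rw [act_monomial]
  simp_rw [Finset.mul_sum]
  rw [Finset.prod_univ_sum, Finset.prod_univ_sum, map_sum]
  refine Finset.sum_congr rfl fun j _ => ?_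
  exact hmon (fun e => (d ((e, true), 0), d ((e, true), 1), j e,
    d ((e, false), 0) + d ((e, false), 1) - j e)) _

theorem UpsilonExt_monomial_of_balanced (A : E → Matrix (Fin 2) (Fin 2) ℂ) (d : Var E →₀ ℕ)
    (hd : ∀ e, d ((e, true), 0) + d ((e, true), 1) = d ((e, false), 0) + d ((e, false), 1)) :
    UpsilonExt (MvPolynomial.monomial d 1) A = ∏ e : E,
      symCoeff (A e) (d ((e, false), 0)) (d ((e, false), 1)) (d ((e, true), 1)) *
        ((-1) ^ d ((e, true), 1) /
          ((d ((e, false), 0) + d ((e, false), 1)).choose (d ((e, true), 1)) : ℂ)) := by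
  rw [UpsilonExt_monomial]
  refine Finset.prod_congr rfl fun e _ => ?_
  have he := hd e
  rw [Finset.sum_eq_single (d ((e, true), 1))]
  · rw [wedge, if_pos ⟨rfl, by omega⟩, he, ← he, Nat.choose_symm_add]
  · intro j _ hj
    rw [wedge, if_neg (by tauto), mul_zero]
  · intro h
    exact absurd (Finset.mem_range.2 (by omega)) h

variable [DecidableEq E]

theorem weight_multidegree (d : Var E →₀ ℕ) (p : E × Bool) :
    Finsupp.weight (multidegree (E := E)) d p = d (p, 0) + d (p, 1) := by
  rw [Finsupp.weight_apply, Finsupp.sum_fintype _ _ (by simp), Finset.sum_apply,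
    Fintype.sum_prod_type]
  simp [multidegree, Pi.single_apply]

theorem balanced_of_mem_support {n : E → ℕ} {v : MvPolynomial (Var E) ℂ} (hv : v ∈ V n)
    {d : Var E →₀ ℕ} (hd : d ∈ v.support) (p : E × Bool) : d (p, 0) + d (p, 1) = n p.1 := by
  rw [← weight_multidegree, hv (MvPolynomial.mem_support_iff.1 hd)]

theorem monomial_mem_V {n : E → ℕ} {d : Var E →₀ ℕ} (hd : ∀ p, d (p, 0) + d (p, 1) = n p.1) :
    MvPolynomial.monomial d (1 : ℂ) ∈ V n := by
  refine MvPolynomial.isWeightedHomogeneous_monomial _ _ _ (funext fun p => ?_)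
  rw [weight_multidegree, hd]

/-- A linear identity between `Υ` and another functional on `𝐕_𝐧` may be checked on monomials. -/
theorem UpsilonExt_induction {n : E → ℕ} (A : E → Matrix (Fin 2) (Fin 2) ℂ)
    (φ : MvPolynomial (Var E) ℂ →ₗ[ℂ] ℂ)
    (h : ∀ d : Var E →₀ ℕ, (∀ p, d (p, 0) + d (p, 1) = n p.1) →
      UpsilonExt (MvPolynomial.monomial d 1) A = φ (MvPolynomial.monomial d 1))
    {v : MvPolynomial (Var E) ℂ} (hv : v ∈ V n) : UpsilonExt v A = φ v := by
  have hs (d : Var E →₀ ℕ) : MvPolynomial.monomial d (v.coeff d) =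
      v.coeff d • MvPolynomial.monomial d (1 : ℂ) := by
    simp [MvPolynomial.smul_monomial]
  rw [v.as_sum]
  simp only [map_sum, Finset.sum_apply, hs, map_smul, Pi.smul_apply]
  refine Finset.sum_congr rfl fun d hd => ?_
  rw [h d (balanced_of_mem_support hv hd)]

/-- The rank one matrices built from one vector at each side of each edge. The vector at the left
side is rotated by a right angle, so that pairing with it by `∧` amounts to evaluation. -/
def rankOne (z : Var E → ℂ) (e : E) : Matrix (Fin 2) (Fin 2) ℂ :=
  Matrix.vecMulVec ![-z ((e, true), 1), z ((e, true), 0)] ![z ((e, false), 0), z ((e, false), 1)]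

/-- On rank one matrices, `Υ(𝐯)` is the evaluation of the polynomial `𝐯`. -/
theorem UpsilonExt_rankOne {n : E → ℕ} {v : MvPolynomial (Var E) ℂ} (hv : v ∈ V n)
    (z : Var E → ℂ) : UpsilonExt v (rankOne z) = MvPolynomial.eval z v := by
  refine UpsilonExt_induction _ (MvPolynomial.aeval z).toLinearMap (fun d hd => ?_) hv
  rw [UpsilonExt_monomial_of_balanced _ _ (fun e => by rw [hd, hd])]
  simp only [AlgHom.toLinearMap_apply, MvPolynomial.aeval_monomial]
  rw [Finsupp.prod_fintype _ _ (by simp), Fintype.prod_prod_type, Fintype.prod_prod_type, map_one,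
    one_mul]
  refine Finset.prod_congr rfl fun e _ => ?_
  have h1 := hd (e, true)
  have h2 := hd (e, false)
  have hle : d ((e, true), 1) ≤ d ((e, false), 0) + d ((e, false), 1) := by
    simp only at h1 h2; omega
  have hsub : d ((e, false), 0) + d ((e, false), 1) - d ((e, true), 1) = d ((e, true), 0) := by
    simp only at h1 h2; omega
  have hc : ((d ((e, false), 0) + d ((e, false), 1)).choose (d ((e, true), 1)) : ℂ) ≠ 0 :=
    Nat.cast_ne_zero.2 (Nat.choose_pos hle).ne'
  rw [rankOne, symCoeff_vecMulVec, hsub, Fintype.prod_bool, Fin.prod_univ_two, Fin.prod_univ_two]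
  simp only [Matrix.cons_val_zero, Matrix.cons_val_one]
  rw [neg_eq_neg_one_mul, mul_pow]
  field_simp
  rw [← pow_mul, mul_comm _ 2, pow_mul]
  simp

theorem UpsilonExt_smul {n : E → ℕ} {v : MvPolynomial (Var E) ℂ} (hv : v ∈ V n)
    (c : ℂ) (A : E → Matrix (Fin 2) (Fin 2) ℂ) :
    UpsilonExt v (c • A) = c ^ (∑ e, n e) * UpsilonExt v A := by
  refine UpsilonExt_induction _
    (c ^ (∑ e, n e) • LinearMap.proj A ∘ₗ UpsilonExt (E := E)) (fun d hd => ?_) hv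
  simp only [LinearMap.smul_apply, LinearMap.comp_apply, LinearMap.proj_apply, smul_eq_mul]
  rw [UpsilonExt_monomial_of_balanced _ _ (fun e => by rw [hd, hd]),
    UpsilonExt_monomial_of_balanced _ _ (fun e => by rw [hd, hd]), ← Finset.prod_pow_eq_pow_sum,
    ← Finset.prod_mul_distrib]
  refine Finset.prod_congr rfl fun e _ => ?_
  rw [Pi.smul_apply, symCoeff_smul, hd (e, false)]
  ring

omit [DecidableEq E] in
/-- The function `𝐀 ↦ Υ(𝐯)(𝐀)` is polynomial in the matrix entries. -/
theorem exists_eval_eq_UpsilonExt (v : MvPolynomial (Var E) ℂ) :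
    ∃ P : MvPolynomial (E × Fin 2 × Fin 2) ℂ, ∀ A : E → Matrix (Fin 2) (Fin 2) ℂ,
      UpsilonExt v A = MvPolynomial.eval (fun i => A i.1 i.2.1 i.2.2) P := by
  induction v using MvPolynomial.induction_on' with
  | monomial d a =>
    let M (e : E) : Matrix (Fin 2) (Fin 2) (MvPolynomial (E × Fin 2 × Fin 2) ℂ) :=
      Matrix.of fun i j => MvPolynomial.X (e, i, j)
    refine ⟨MvPolynomial.C a * ∏ e : E,
      ∑ j ∈ Finset.range (d ((e, false), 0) + d ((e, false), 1) + 1),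
        symCoeff (M e) (d ((e, false), 0)) (d ((e, false), 1)) j *
          MvPolynomial.C (wedge (d ((e, true), 0)) (d ((e, true), 1)) j
            (d ((e, false), 0) + d ((e, false), 1) - j)), fun A => ?_⟩
    have hM (e : E) : (M e).map (MvPolynomial.eval fun i => A i.1 i.2.1 i.2.2) = A e := by
      ext i j; simp [M]
    have hs : MvPolynomial.monomial d a = a • MvPolynomial.monomial d (1 : ℂ) := by
      simp [MvPolynomial.smul_monomial]
    rw [hs, map_smul, Pi.smul_apply, UpsilonExt_monomial]
    simp only [map_mul, map_prod, map_sum, MvPolynomial.eval_C, ← symCoeff_map, hM, smul_eq_mul]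
  | add p q hp hq =>
    obtain ⟨P, hP⟩ := hp
    obtain ⟨Q, hQ⟩ := hq
    exact ⟨P + Q, fun A => by rw [map_add, Pi.add_apply, hP, hQ, map_add]⟩

end Monomials

/-! ### Polynomial functions are in the image of `Υ` -/

section Surjectivity

variable {E : Type} [Fintype E]

/-- The span of products over the edges of matrix coefficients of symmetric powers. -/
def symCoeffSpan (E : Type) [Fintype E] :
    Submodule ℂ ((E → Matrix.SpecialLinearGroup (Fin 2) ℂ) → ℂ) :=
  Submodule.span ℂ (Set.range fun (κ : E → ℕ × ℕ × ℕ) A =>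
    ∏ e, symCoeff (A e : Matrix (Fin 2) (Fin 2) ℂ) (κ e).1 (κ e).2.1 (κ e).2.2)

/-- For `det M = 1`, the product of a matrix entry and a matrix coefficient of a symmetric power
is a linear combination of matrix coefficients: an elementary form of the Clebsch–Gordan
decomposition of the product with the two-dimensional representation. -/
theorem exists_entry_mul_symCoeff (i i' : Fin 2) (k l j : ℕ) :
    ∃ c : Fin 3 → ℂ, ∃ κ : Fin 3 → ℕ × ℕ × ℕ, ∀ M : Matrix (Fin 2) (Fin 2) ℂ, M.det = 1 →
      M i i' * symCoeff M k l j = ∑ r, c r * symCoeff M (κ r).1 (κ r).2.1 (κ r).2.2 := by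
  have h0 (k l : ℕ) : (k + l + 1 : ℂ) ≠ 0 := by
    exact_mod_cast Nat.succ_ne_zero (k + l)
  have h00 (k l j : ℕ) (M : Matrix (Fin 2) (Fin 2) ℂ) (hM : M.det = 1) :
      M 0 0 * symCoeff M k l j = ((j + 1) / (k + l + 1) : ℂ) * symCoeff M (k + 1) l (j + 1) +
        (l / (k + l + 1) : ℂ) * symCoeff M k (l - 1) j := by
    have h := entry00_mul_symCoeff M k l j
    rw [hM] at h
    push_cast at h
    have := h0 k l
    field_simp
    linear_combination h
  have h01 (k l j : ℕ) (M : Matrix (Fin 2) (Fin 2) ℂ) (hM : M.det = 1) :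
      M 0 1 * symCoeff M k l j = ((j + 1) / (k + l + 1) : ℂ) * symCoeff M k (l + 1) (j + 1) +
        (-k / (k + l + 1) : ℂ) * symCoeff M (k - 1) l j := by
    have h := entry01_mul_symCoeff M k l j
    rw [hM] at h
    push_cast at h
    have := h0 k l
    field_simp
    linear_combination h
  fin_cases i <;> fin_cases i'
  · exact ⟨![_, _, 0], ![(_, _, _), (_, _, _), 0], fun M hM => by
      simpa [Fin.sum_univ_three] using h00 k l j M hM⟩
  · exact ⟨![_, _, 0], ![(_, _, _), (_, _, _), 0], fun M hM => by
      simpa [Fin.sum_univ_three] using h01 k l j M hM⟩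
  · rcases j with _ | j
    · exact ⟨![1, 0, 0], ![(k + 1, l, 0), 0, 0], fun M hM => by
        simp [Fin.sum_univ_three, symCoeff_succ_left_zero]⟩
    · refine ⟨![1, -((j + 1) / (k + l + 1) : ℂ), -(l / (k + l + 1) : ℂ)],
        ![(k + 1, l, j + 1), (k + 1, l, j + 1), (k, l - 1, j)], fun M hM => ?_⟩
      have h1 := symCoeff_succ_left_succ M k l j
      have h2 := h00 k l j M hM
      simp only [Fin.sum_univ_three, Matrix.cons_val]
      simp only [Fin.zero_eta, Fin.mk_one]
      linear_combination -h1 - h2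
  · rcases j with _ | j
    · exact ⟨![1, 0, 0], ![(k, l + 1, 0), 0, 0], fun M hM => by
        simp [Fin.sum_univ_three, symCoeff_succ_right_zero]⟩
    · refine ⟨![1, -((j + 1) / (k + l + 1) : ℂ), -(-k / (k + l + 1) : ℂ)],
        ![(k, l + 1, j + 1), (k, l + 1, j + 1), (k - 1, l, j)], fun M hM => ?_⟩
      have h1 := symCoeff_succ_right_succ M k l j
      have h2 := h01 k l j M hM
      simp only [Fin.sum_univ_three, Matrix.cons_val]
      simp only [Fin.mk_one]
      linear_combination -h1 - h2

theorem entry_mul_mem_symCoeffSpan (e : E) (i i' : Fin 2)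
    {f : (E → Matrix.SpecialLinearGroup (Fin 2) ℂ) → ℂ} (hf : f ∈ symCoeffSpan E) :
    (fun A => (A e : Matrix (Fin 2) (Fin 2) ℂ) i i' * f A) ∈ symCoeffSpan E := by
  classical
  let m : ((E → Matrix.SpecialLinearGroup (Fin 2) ℂ) → ℂ) →ₗ[ℂ] _ :=
    LinearMap.mulLeft ℂ fun A => (A e : Matrix (Fin 2) (Fin 2) ℂ) i i'
  suffices h : symCoeffSpan E ≤ (symCoeffSpan E).comap m from h hf
  rw [symCoeffSpan, Submodule.span_le]
  rintro _ ⟨κ, rfl⟩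
  obtain ⟨c, κ', h⟩ := exists_entry_mul_symCoeff i i' (κ e).1 (κ e).2.1 (κ e).2.2
  have : m (fun A => ∏ e, symCoeff (A e : Matrix (Fin 2) (Fin 2) ℂ) (κ e).1 (κ e).2.1 (κ e).2.2) =
      ∑ r, c r • fun A : E → Matrix.SpecialLinearGroup (Fin 2) ℂ =>
        ∏ e', symCoeff (A e' : Matrix (Fin 2) (Fin 2) ℂ) (Function.update κ e (κ' r) e').1
          (Function.update κ e (κ' r) e').2.1 (Function.update κ e (κ' r) e').2.2 := by
    ext A
    simp only [m, LinearMap.mulLeft_apply, Pi.mul_apply, Finset.sum_apply, Pi.smul_apply,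
      smul_eq_mul]
    rw [← Finset.mul_prod_erase _ _ (Finset.mem_univ e), ← mul_assoc, h _ (A e).det_coe,
      Finset.sum_mul]
    refine Finset.sum_congr rfl fun r _ => ?_
    rw [← Finset.mul_prod_erase _ _ (Finset.mem_univ e), Function.update_self, ← mul_assoc]
    congr 1
    refine Finset.prod_congr rfl fun e' he' => ?_
    rw [Function.update_of_ne (Finset.ne_of_mem_erase he')]
  rw [SetLike.mem_coe, Submodule.mem_comap, this]
  exact Submodule.sum_mem _ fun r _ =>
    Submodule.smul_mem _ _ (Submodule.subset_span ⟨_, rfl⟩)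

theorem eval_mem_symCoeffSpan (P : MvPolynomial (E × Fin 2 × Fin 2) ℂ) :
    (fun A : E → Matrix.SpecialLinearGroup (Fin 2) ℂ =>
      MvPolynomial.eval (fun i => (A i.1 : Matrix (Fin 2) (Fin 2) ℂ) i.2.1 i.2.2) P) ∈
      symCoeffSpan E := by
  induction P using MvPolynomial.induction_on with
  | C a =>
    have : (1 : (E → Matrix.SpecialLinearGroup (Fin 2) ℂ) → ℂ) ∈ symCoeffSpan E :=
      Submodule.subset_span ⟨0, by ext A; simp [symCoeff]⟩
    convert Submodule.smul_mem _ a this using 1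
    ext A; simp
  | add p q hp hq =>
    convert Submodule.add_mem _ hp hq using 1
    ext A; simp
  | mul_X p i hp =>
    convert entry_mul_mem_symCoeffSpan i.1 i.2.1 i.2.2 hp using 2 with A
    simp [mul_comm]

variable [DecidableEq E]

theorem Upsilon_of (n : E → ℕ) (v : V n) (A : E → Matrix.SpecialLinearGroup (Fin 2) ℂ) :
    Upsilon (DirectSum.lof ℂ (E → ℕ) (fun n => V n) n v) A =
      UpsilonExt (v : MvPolynomial (Var E) ℂ) (fun e => (A e : Matrix (Fin 2) (Fin 2) ℂ)) := by
  rw [Upsilon, DirectSum.toModule_lof]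
  rfl

theorem symCoeffSpan_le_range_Upsilon : symCoeffSpan E ≤ LinearMap.range (Upsilon (E := E)) := by
  rw [symCoeffSpan, Submodule.span_le]
  rintro _ ⟨κ, rfl⟩
  by_cases hκ : ∀ e, (κ e).2.2 ≤ (κ e).1 + (κ e).2.1
  · let d : Var E →₀ ℕ := Finsupp.equivFunOnFinite.symm fun v =>
      if v.1.2 then
        (if v.2 = 0 then (κ v.1.1).1 + (κ v.1.1).2.1 - (κ v.1.1).2.2 else (κ v.1.1).2.2)
      else (if v.2 = 0 then (κ v.1.1).1 else (κ v.1.1).2.1)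
    have hd (p : E × Bool) : d (p, 0) + d (p, 1) = (κ p.1).1 + (κ p.1).2.1 := by
      have := hκ p.1
      rcases p with ⟨e, _ | _⟩
      · simp [d]
      · simp only at this
        simp [d]
        omega
    let c : ℂ := ∏ e : E, ((-1) ^ d ((e, true), 1) /
          ((d ((e, false), 0) + d ((e, false), 1)).choose (d ((e, true), 1)) : ℂ))
    have hc : c ≠ 0 := by
      refine Finset.prod_ne_zero_iff.2 fun e _ => div_ne_zero (by simp) ?_
      exact Nat.cast_ne_zero.2 (Nat.choose_pos (by simpa [d] using hκ e)).ne'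
    refine ⟨c⁻¹ • DirectSum.lof ℂ (E → ℕ) (fun n => V n) (fun e => (κ e).1 + (κ e).2.1)
      ⟨_, monomial_mem_V hd⟩, ?_⟩
    ext A
    rw [map_smul, Pi.smul_apply, Upsilon_of,
      UpsilonExt_monomial_of_balanced _ _ (fun e => by rw [hd, hd]), Finset.prod_mul_distrib,
      smul_eq_mul]
    change c⁻¹ * (_ * c) = _
    rw [mul_comm _ c, inv_mul_cancel_left₀ hc]
    simp [d]
  · push Not at hκ
    obtain ⟨e, he⟩ := hκ
    refine ⟨0, ?_⟩
    ext A
    rw [map_zero]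
    exact (Finset.prod_eq_zero (Finset.mem_univ e) (symCoeff_eq_zero _ he)).symm

/-- The part of the Peter–Weyl theorem asserting that `Υ` is onto. -/
theorem exists_Upsilon_eq_eval (P : MvPolynomial (E × Fin 2 × Fin 2) ℂ) :
    ∃ x, Upsilon x = fun A : E → Matrix.SpecialLinearGroup (Fin 2) ℂ =>
      MvPolynomial.eval (fun i => (A i.1 : Matrix (Fin 2) (Fin 2) ℂ) i.2.1 i.2.2) P :=
  symCoeffSpan_le_range_Upsilon (eval_mem_symCoeffSpan P)

end Surjectivity

/-! ### The leading Peter–Weyl component -/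

section LeadingComponent

open Filter Topology

variable {E : Type} [Fintype E] [DecidableEq E]

theorem Upsilon_apply (x : DirectSum (E → ℕ) (fun n => V n))
    (A : E → Matrix.SpecialLinearGroup (Fin 2) ℂ) :
    Upsilon x A = ∑ n ∈ DFinsupp.support x,
      UpsilonExt (x n : MvPolynomial (Var E) ℂ) (fun e => (A e : Matrix (Fin 2) (Fin 2) ℂ)) := by
  conv_lhs => rw [← DirectSum.sum_support_of x]
  rw [map_sum, Finset.sum_apply]
  exact Finset.sum_congr rfl fun n _ => Upsilon_of n (x n) A

omit [DecidableEq E] in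
theorem continuous_UpsilonExt (v : MvPolynomial (Var E) ℂ) :
    Continuous fun A => UpsilonExt v A := by
  obtain ⟨P, hP⟩ := exists_eval_eq_UpsilonExt v
  simp_rw [hP]
  exact (MvPolynomial.continuous_eval P).comp (by fun_prop)

/-- Moving from a rank one matrix in this direction changes the determinant linearly. -/
noncomputable def transversal (z : Var E → ℂ) (e : E) : Matrix (Fin 2) (Fin 2) ℂ :=
  !![0, -(z ((e, true), 0) * z ((e, false), 0))⁻¹; 0, 0]

omit [Fintype E] [DecidableEq E] in
theorem det_rankOne_add_smul_transversal {z : Var E → ℂ} (hz : ∀ p, z (p, 0) ≠ 0) (s : ℂ) (e : E) :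
    (rankOne z e + s • transversal z e).det = s := by
  have h1 := hz (e, true)
  have h2 := hz (e, false)
  simp only [Matrix.det_fin_two, rankOne, transversal, Matrix.add_apply, Matrix.smul_apply,
    Matrix.vecMulVec_apply, Matrix.of_apply, Matrix.cons_val', Matrix.cons_val_zero,
    Matrix.cons_val_one, Matrix.cons_val_fin_one, smul_eq_mul]
  field_simp
  ring

/-- Comparison of the leading terms of `Υ(x) = g` as the matrices `t⁻¹ (A₀ + t² B)` of determinant
one tend to infinity in the direction of the rank one matrices `A₀`. -/
theorem sum_eval_leading_eq {x : DirectSum (E → ℕ) (fun n => V n)}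
    {g : (E → Matrix (Fin 2) (Fin 2) ℂ) → ℂ} {N M : ℕ} (hg : Continuous g)
    (hgN : ∀ (c : ℂ) A, g (c • A) = c ^ N * g A)
    (hx : ∀ A : E → Matrix.SpecialLinearGroup (Fin 2) ℂ,
      Upsilon x A = g fun e => (A e : Matrix (Fin 2) (Fin 2) ℂ))
    (hNM : N ≤ M) (hM : ∀ n ∈ DFinsupp.support x, ∑ e, n e ≤ M)
    {z : Var E → ℂ} (hz : ∀ p, z (p, 0) ≠ 0) :
    ∑ n ∈ DFinsupp.support x with ∑ e, n e = M, MvPolynomial.eval z (x n : MvPolynomial (Var E) ℂ) =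
      if M = N then g (rankOne z) else 0 := by
  let A (t : ℂ) : E → Matrix (Fin 2) (Fin 2) ℂ := rankOne z + t ^ 2 • transversal z
  have hA : Continuous A := by fun_prop
  have hpos (t : ℂ) (ht : t ≠ 0) :
      ∑ n ∈ DFinsupp.support x, t ^ (M - ∑ e, n e) *
        UpsilonExt (x n : MvPolynomial (Var E) ℂ) (A t) = t ^ (M - N) * g (A t) := by
    have hdet (e : E) : (t⁻¹ • A t e).det = 1 := by
      rw [Matrix.det_smul, Fintype.card_fin]
      simp only [A, Pi.add_apply, Pi.smul_apply]
      rw [det_rankOne_add_smul_transversal hz]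
      field_simp
    let A' (e : E) : Matrix.SpecialLinearGroup (Fin 2) ℂ := ⟨t⁻¹ • A t e, hdet e⟩
    have h := (Upsilon_apply x A').symm.trans (hx A')
    change ∑ n ∈ DFinsupp.support x, UpsilonExt (x n : MvPolynomial (Var E) ℂ) (t⁻¹ • A t) =
      g (t⁻¹ • A t) at h
    rw [hgN] at h
    have h2 := congrArg (t ^ M * ·) h
    simp only [Finset.mul_sum] at h2
    convert h2 using 1
    · refine Finset.sum_congr rfl fun n hn => ?_
      rw [UpsilonExt_smul (x n).2, pow_sub₀ _ ht (hM n hn), inv_pow, mul_assoc]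
    · rw [pow_sub₀ _ ht hNM, inv_pow, mul_assoc]
  have hc1 : Continuous fun t => ∑ n ∈ DFinsupp.support x, t ^ (M - ∑ e, n e) *
        UpsilonExt (x n : MvPolynomial (Var E) ℂ) (A t) :=
    continuous_finsetSum _ fun n _ =>
      (continuous_pow _).mul ((continuous_UpsilonExt _).comp hA)
  have hc2 : Continuous fun t => t ^ (M - N) * g (A t) :=
    (continuous_pow _).mul (hg.comp hA)
  have h0 := congrFun (hc1.ext_on (dense_compl_singleton (0 : ℂ)) hc2 fun t ht => hpos t ht) 0
  have hA0 : A 0 = rankOne z := by simp [A]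
  simp only [hA0] at h0
  rw [Finset.sum_filter]
  convert h0 using 1
  · refine Finset.sum_congr rfl fun n hn => ?_
    have := hM n hn
    rw [UpsilonExt_rankOne (x n).2]
    split_ifs with h
    · simp [h]
    · rw [zero_pow (by omega), zero_mul]
  · split_ifs with h
    · simp [h]
    · rw [zero_pow (by omega), zero_mul]

/-- A homogeneous function on `SL₂(ℂ)^E` has a Peter–Weyl component of top degree that is
determined by its values on rank one matrices. -/
theorem component_eq_of_eval_rankOne {x : DirectSum (E → ℕ) (fun n => V n)}
    {g : (E → Matrix (Fin 2) (Fin 2) ℂ) → ℂ} {n : E → ℕ} (hg : Continuous g)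
    (hgn : ∀ (c : ℂ) A, g (c • A) = c ^ (∑ e, n e) * g A)
    (hx : ∀ A : E → Matrix.SpecialLinearGroup (Fin 2) ℂ,
      Upsilon x A = g fun e => (A e : Matrix (Fin 2) (Fin 2) ℂ))
    {Q : MvPolynomial (Var E) ℂ} (hQ : Q ∈ V n)
    (hgQ : ∀ z, g (rankOne z) = MvPolynomial.eval z Q) :
    (x n : MvPolynomial (Var E) ℂ) = Q := by
  classical
  have key (M : ℕ) (hNM : ∑ e, n e ≤ M) (hM : ∀ n ∈ DFinsupp.support x, ∑ e, n e ≤ M) :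
      ∑ k ∈ DFinsupp.support x with ∑ e, k e = M, (x k : MvPolynomial (Var E) ℂ) =
        if M = ∑ e, n e then Q else 0 := by
    refine MvPolynomial.funext_set (fun v => if v.2 = 0 then {0}ᶜ else Set.univ)
      (fun v => ?_) fun z hz => ?_
    · split_ifs
      · exact (Set.finite_singleton _).infinite_compl
      · exact Set.infinite_univ
    · have hz0 (p : E × Bool) : z (p, 0) ≠ 0 := by simpa using hz (p, 0) (Set.mem_univ _)
      rw [map_sum, sum_eval_leading_eq hg hgn hx hNM hM hz0, hgQ]
      split_ifs <;> simp
  have comp (M : ℕ) (k : E → ℕ) : MvPolynomial.weightedHomogeneousComponent multidegree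
      (fun p : E × Bool => k p.1)
      (∑ k ∈ DFinsupp.support x with ∑ e, k e = M, (x k : MvPolynomial (Var E) ℂ)) =
      if ∑ e, k e = M then (x k : MvPolynomial (Var E) ℂ) else 0 := by
    have hne (k k' : E → ℕ) (h : k ≠ k') :
        (fun p : E × Bool => k p.1) ≠ fun p : E × Bool => k' p.1 := fun h' =>
      h (funext fun e => congrFun h' (e, true))
    rw [map_sum]
    have hterm (k' : E → ℕ) : MvPolynomial.weightedHomogeneousComponent multidegree
        (fun p : E × Bool => k p.1) (x k' : MvPolynomial (Var E) ℂ) =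
        if k = k' then (x k' : MvPolynomial (Var E) ℂ) else 0 := by
      split_ifs with h
      · subst h
        exact MvPolynomial.IsWeightedHomogeneous.weightedHomogeneousComponent_same (x k).2
      · exact MvPolynomial.IsWeightedHomogeneous.weightedHomogeneousComponent_ne _ (x k').2
          (hne _ _ h)
    simp_rw [hterm]
    rw [Finset.sum_ite_eq]
    by_cases hk : k ∈ DFinsupp.support x
    · simp [hk]
    · have : x k = 0 := by simpa using hk
      simp [this]
  -- the largest total degree occurring in `x` cannot exceed the degree of `g`
  have hle : ∀ k ∈ DFinsupp.support x, ∑ e, k e ≤ ∑ e, n e := by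
    by_contra! hcon
    obtain ⟨k, hk, hkn⟩ := hcon
    obtain ⟨k', hk', hmax⟩ := Finset.exists_max_image (DFinsupp.support x) (fun k => ∑ e, k e) ⟨k, hk⟩
    have hlt : ∑ e, n e < ∑ e, k' e := hkn.trans_le (hmax k hk)
    have h := comp (∑ e, k' e) k'
    rw [key _ hlt.le hmax, if_neg hlt.ne', map_zero, if_pos rfl] at h
    exact (DFinsupp.mem_support_iff.1 hk') (Subtype.ext h.symm)
  have h := comp (∑ e, n e) n
  rw [key _ le_rfl hle, if_pos rfl, if_pos rfl,
    MvPolynomial.IsWeightedHomogeneous.weightedHomogeneousComponent_same hQ] at h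
  exact h.symm

end LeadingComponent

namespace Lamination

/-! ### The loops of a lamination -/

section Loops

variable {E F : Type} {T : Gluing E F} (Γ : Lamination T)

theorem cross_cross (s : Point Γ.num) : Γ.cross (Γ.cross s) = s :=
  Γ.cross.left_inv s

theorem cross_ne (s : Point Γ.num) : Γ.cross s ≠ s := by
  intro h
  have := congrArg (fun s : Point Γ.num => s.1.2) h
  simp [cross, Gluing.opp] at this

theorem chord_ne (s : Point Γ.num) : Γ.chord s ≠ s :=
  fun h => Γ.chord_side s (congrArg Sigma.fst h)

theorem step_apply (s : Point Γ.num) : Γ.step s = Γ.chord (Γ.cross s) := rfl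

theorem chord_step (s : Point Γ.num) : Γ.chord (Γ.step s) = Γ.cross s :=
  Γ.chord_chord _

/-- Crossings reverse the direction of motion along a loop. -/
theorem step_iterate_cross_step_iterate (i : ℕ) (s : Point Γ.num) :
    Γ.step^[i] (Γ.cross (Γ.step^[i] s)) = Γ.cross s := by
  induction i generalizing s with
  | zero => rfl
  | succ i ih =>
    rw [Function.iterate_succ_apply', Function.iterate_succ_apply, ih, step_apply, cross_cross,
      chord_step]

/-- The two directions of motion along a loop visit different points; otherwise, in the middle
between a point and its reversal there would be a fixed point of a crossing or of a chord. -/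
theorem cross_ne_step_iterate (m : ℕ) (s : Point Γ.num) : Γ.cross s ≠ Γ.step^[m] s := by
  intro h
  rcases Nat.even_or_odd' m with ⟨k, rfl | rfl⟩
  · rw [← Γ.step_iterate_cross_step_iterate k, two_mul, Function.iterate_add_apply] at h
    exact Γ.cross_ne _ ((Γ.step.injective.iterate k) h)
  · rw [← Γ.step_iterate_cross_step_iterate k, two_mul, add_assoc,
      Function.iterate_add_apply] at h
    have h := (Γ.step.injective.iterate k) h
    rw [Function.iterate_succ_apply', step_apply] at h
    exact Γ.chord_ne _ h.symm

theorem cross_step_iterate_ne (i j : ℕ) (s : Point Γ.num) :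
    Γ.cross (Γ.step^[i] s) ≠ Γ.step^[j] s := by
  intro h
  rcases le_total i j with hij | hij
  · obtain ⟨m, rfl⟩ := Nat.exists_eq_add_of_le' hij
    rw [Function.iterate_add_apply] at h
    exact Γ.cross_ne_step_iterate m _ h
  · obtain ⟨m, rfl⟩ := Nat.exists_eq_add_of_le' hij
    rw [Function.iterate_add_apply] at h
    refine Γ.cross_ne_step_iterate m (Γ.step^[j] s) ?_
    rw [← h, cross_cross, h]

variable [Fintype E]

/-- The loop passing through a point. -/
def loopOf (s : Point Γ.num) : Γ.Loop := Quotient.mk _ s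

instance : Finite Γ.Loop := Quotient.finite _

theorem minimalPeriod_step_pos (s : Point Γ.num) : 0 < Function.minimalPeriod Γ.step s :=
  Function.minimalPeriod_pos_of_mem_periodicPts (Γ.step.injective.mem_periodicPts s)

/-- The loop of a point consists of the points visited when moving along the loop in one of the two
directions. -/
theorem loopOf_eq_loopOf_iff (s r : Point Γ.num) :
    Γ.loopOf s = Γ.loopOf r ↔
      ∃ i < Function.minimalPeriod Γ.step r, s = Γ.step^[i] r ∨ s = Γ.cross (Γ.step^[i] r) := by
  have hper (i : ℕ) : ∃ j < Function.minimalPeriod Γ.step r, Γ.step^[i] r = Γ.step^[j] r :=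
    ⟨_, Nat.mod_lt _ (Γ.minimalPeriod_step_pos r), Function.iterate_mod_minimalPeriod_eq.symm⟩
  have hcross : Γ.cross ∈ Subgroup.closure ({Γ.cross, Γ.chord} : Set (Equiv.Perm (Point Γ.num))) :=
    Subgroup.subset_closure (by simp)
  have hchord : Γ.chord ∈ Subgroup.closure ({Γ.cross, Γ.chord} : Set (Equiv.Perm (Point Γ.num))) :=
    Subgroup.subset_closure (by simp)
  refine Iff.trans (b := s ∈ MulAction.orbit (Subgroup.closure
    ({Γ.cross, Γ.chord} : Set (Equiv.Perm (Point Γ.num)))) r) Quotient.eq ?_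
  constructor
  · rintro ⟨⟨g, hg⟩, rfl⟩
    let C : Set (Point Γ.num) := {s | ∃ i, s = Γ.step^[i] r ∨ s = Γ.cross (Γ.step^[i] r)}
    have hCx (s) (hs : s ∈ C) : Γ.cross s ∈ C := by
      obtain ⟨i, rfl | rfl⟩ := hs
      · exact ⟨i, Or.inr rfl⟩
      · exact ⟨i, Or.inl (Γ.cross_cross _)⟩
    have hCc (s) (hs : s ∈ C) : Γ.chord s ∈ C := by
      obtain ⟨i, rfl | rfl⟩ := hs
      · obtain ⟨p, hp⟩ := Nat.exists_eq_succ_of_ne_zero (Γ.minimalPeriod_step_pos r).ne'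
        refine ⟨i + p, Or.inr ?_⟩
        have : Γ.step^[i] r = Γ.step (Γ.step^[i + p] r) := by
          rw [← Function.iterate_succ_apply' Γ.step, ← Nat.add_succ, Function.iterate_add_apply, ← hp,
            Function.iterate_minimalPeriod]
        rw [this, chord_step]
      · exact ⟨i + 1, Or.inl (by rw [Function.iterate_succ_apply', step_apply])⟩
    have hC : ∀ s, s ∈ C ↔ g s ∈ C := by
      induction hg using Subgroup.closure_induction with
      | mem x hx =>
        rcases hx with rfl | rfl
        · exact fun s => ⟨hCx s, fun h => by simpa [cross_cross] using hCx _ h⟩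
        · exact fun s => ⟨hCc s, fun h => by simpa [Γ.chord_chord] using hCc _ h⟩
      | one => simp
      | mul x y _ _ hx hy => exact fun s => (hy s).trans (hx _)
      | inv x _ hx => exact fun s => by simpa using (hx (x⁻¹ s)).symm
    obtain ⟨i, hi⟩ := (hC r).1 ⟨0, Or.inl rfl⟩
    obtain ⟨j, hj, hij⟩ := hper i
    exact ⟨j, hj, by rw [← hij]; exact hi⟩
  · rintro ⟨i, -, h⟩
    have hi : Γ.step^[i] r ∈ MulAction.orbit
        (Subgroup.closure ({Γ.cross, Γ.chord} : Set (Equiv.Perm (Point Γ.num)))) r := by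
      refine ⟨⟨Γ.step ^ i, Subgroup.pow_mem _ (Subgroup.mul_mem _ hchord hcross) i⟩, ?_⟩
      simp [Subgroup.smul_def, ← Equiv.Perm.iterate_eq_pow]
    rcases h with rfl | rfl
    · exact hi
    · obtain ⟨g, hg⟩ := hi
      refine ⟨⟨Γ.cross, hcross⟩ * g, ?_⟩
      simp only at hg
      simp only [mul_smul, hg]
      rfl

/-- A product over all points, written along the loops: every loop is traversed once in one
direction, and every crossing point is seen from both sides. -/
@[to_additive /-- A sum over all points, written along the loops: every loop is traversed once in
one direction, and every crossing point is seen from both sides. -/]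
theorem prod_points {M : Type*} [CommMonoid M] [Fintype Γ.Loop] (g : Point Γ.num → M) :
    ∏ s, g s = ∏ γ : Γ.Loop, ∏ i ∈ Finset.range (Function.minimalPeriod Γ.step (Quotient.out γ)),
      g (Γ.step^[i] (Quotient.out γ)) * g (Γ.cross (Γ.step^[i] (Quotient.out γ))) := by
  classical
  rw [← Finset.prod_fiberwise Finset.univ Γ.loopOf g]
  refine Finset.prod_congr rfl fun γ _ => ?_
  set r := Quotient.out γ with hr
  have hinj : Set.InjOn (fun i => Γ.step^[i] r)
      (Finset.range (Function.minimalPeriod Γ.step r)) := fun i hi j hj h =>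
    Function.iterate_injOn_Iio_minimalPeriod (by simpa using hi) (by simpa using hj) h
  have hfib : Finset.univ.filter (fun s => Γ.loopOf s = γ) =
      (Finset.range (Function.minimalPeriod Γ.step r)).image (fun i => Γ.step^[i] r) ∪
      (Finset.range (Function.minimalPeriod Γ.step r)).image
        (fun i => Γ.cross (Γ.step^[i] r)) := by
    ext s
    have hγ : γ = Γ.loopOf r := (Quotient.out_eq γ).symm
    rw [Finset.mem_filter, hγ, loopOf_eq_loopOf_iff]
    simp only [Finset.mem_univ, true_and, Finset.mem_union, Finset.mem_image, Finset.mem_range]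
    constructor
    · rintro ⟨i, hi, rfl | rfl⟩
      · exact Or.inl ⟨i, hi, rfl⟩
      · exact Or.inr ⟨i, hi, rfl⟩
    · rintro (⟨i, hi, rfl⟩ | ⟨i, hi, rfl⟩)
      · exact ⟨i, hi, Or.inl rfl⟩
      · exact ⟨i, hi, Or.inr rfl⟩
  have hdisj : Disjoint
      ((Finset.range (Function.minimalPeriod Γ.step r)).image (fun i => Γ.step^[i] r))
      ((Finset.range (Function.minimalPeriod Γ.step r)).image
        (fun i => Γ.cross (Γ.step^[i] r))) := by
    rw [Finset.disjoint_left]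
    intro s hs hs'
    obtain ⟨i, -, rfl⟩ := Finset.mem_image.1 hs
    obtain ⟨j, -, hj⟩ := Finset.mem_image.1 hs'
    exact Γ.cross_step_iterate_ne j i r hj
  rw [hfib, Finset.prod_union hdisj, Finset.prod_image hinj,
    Finset.prod_image fun i hi j hj h => hinj hi hj (Γ.cross.injective h),
    Finset.prod_mul_distrib]

/-- A product over all points, written along the loops as a product over the chords. -/
@[to_additive /-- A sum over all points, written along the loops as a sum over the chords. -/]
theorem prod_points_chord {M : Type*} [CommMonoid M] [Fintype Γ.Loop] (g : Point Γ.num → M) :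
    ∏ s, g s = ∏ γ : Γ.Loop, ∏ i ∈ Finset.range (Function.minimalPeriod Γ.step (Quotient.out γ)),
      g (Γ.cross (Γ.step^[i] (Quotient.out γ))) * g (Γ.step (Γ.step^[i] (Quotient.out γ))) := by
  rw [prod_points]
  refine Finset.prod_congr rfl fun γ _ => ?_
  rw [Finset.prod_mul_distrib, Finset.prod_mul_distrib, mul_comm]
  congr 1
  obtain ⟨p, hp⟩ := Nat.exists_eq_succ_of_ne_zero (Γ.minimalPeriod_step_pos (Quotient.out γ)).ne'
  simp_rw [← Function.iterate_succ_apply' Γ.step]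
  have h := Function.iterate_minimalPeriod (f := Γ.step) (x := Quotient.out γ)
  rw [hp] at h ⊢
  rw [Finset.prod_range_succ' (fun i => g (Γ.step^[i] _)), Finset.prod_range_succ, h]
  rfl

theorem sum_minimalPeriod [Fintype Γ.Loop] :
    ∑ γ : Γ.Loop, Function.minimalPeriod Γ.step (Quotient.out γ) = Γ.complexity := by
  have h := Γ.sum_points fun _ => 1
  simp only [Finset.sum_const, Finset.card_range, smul_eq_mul, Finset.card_univ, mul_one] at h
  rw [Fintype.card_sigma, Fintype.sum_prod_type] at h
  simp only [Fintype.card_fin, Fintype.sum_bool, ← two_mul, ← Finset.mul_sum] at h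
  rw [← Finset.sum_mul] at h
  rw [complexity]
  omega

end Loops
end Lamination

/-- The trace of a product of rank one matrices `cᵢ wᵢᵀ`, with indices in cyclic order. -/
theorem trace_prod_vecMulVec {R : Type*} [CommRing R] {p : ℕ} (hp : 0 < p)
    (c w : ℕ → Fin 2 → R) (hc : c p = c 0) :
    (((List.range p).map fun i => Matrix.vecMulVec (c i) (w i)).prod).trace =
      ∏ i ∈ Finset.range p, w i ⬝ᵥ c (i + 1) := by
  obtain ⟨k, rfl⟩ := Nat.exists_eq_succ_of_ne_zero hp.ne'
  have h (k : ℕ) : ((List.range (k + 1)).map fun i => Matrix.vecMulVec (c i) (w i)).prod =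
      (∏ i ∈ Finset.range k, w i ⬝ᵥ c (i + 1)) • Matrix.vecMulVec (c 0) (w k) := by
    induction k with
    | zero => simp
    | succ k ih =>
      rw [List.range_succ, List.map_append, List.prod_append, ih, Finset.prod_range_succ]
      simp [Matrix.vecMulVec_mul_vecMulVec, Matrix.vecMulVec_smul, smul_smul]
  rw [h, Finset.prod_range_succ, hc, Matrix.trace_smul, Matrix.trace_vecMulVec, smul_eq_mul,
    dotProduct_comm (c 0)]

namespace Lamination

/-! ### The polynomial extension of `f_Γ` -/

section Extension

variable {E F : Type} {T : Gluing E F} (Γ : Lamination T)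

/-- The factor of the holonomy that corresponds to crossing an edge, with the inverse matrix
replaced by the adjugate. -/
def crossingAdj {R : Type*} [CommRing R] (A : E → Matrix (Fin 2) (Fin 2) R) (s : Point Γ.num) :
    Matrix (Fin 2) (Fin 2) R :=
  if s.1.2 then A s.1.1 else (A s.1.1).adjugate

/-- The extension of `f_Γ` to arbitrary matrices in which inverses are replaced by adjugates. -/
noncomputable def fExt {R : Type*} [CommRing R] (A : E → Matrix (Fin 2) (Fin 2) R) : R :=
  ∏ᶠ γ : Γ.Loop, Matrix.trace ((List.range (Function.minimalPeriod Γ.step (Quotient.out γ))).map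
    fun i => Γ.crossingAdj A (Γ.step^[i] (Quotient.out γ))).prod

theorem f_eq_fExt (A : E → Matrix.SpecialLinearGroup (Fin 2) ℂ) :
    Γ.f A = Γ.fExt fun e => (A e : Matrix (Fin 2) (Fin 2) ℂ) := by
  have hprod (l : List ℕ) (g : ℕ → Matrix.SpecialLinearGroup (Fin 2) ℂ) :
      ((l.map g).prod : Matrix (Fin 2) (Fin 2) ℂ) =
        (l.map fun i => (g i : Matrix (Fin 2) (Fin 2) ℂ)).prod := by
    induction l with
    | nil => simp
    | cons a l ih => simp [ih]
  rw [f, fExt]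
  refine finprod_congr fun γ => ?_
  rw [hol, hprod]
  congr 3
  ext1 i
  simp only [crossingMatrix, crossingAdj]
  split_ifs
  · rfl
  · exact Matrix.SpecialLinearGroup.coe_inv _

variable [Fintype E]

theorem map_fExt {R S : Type*} [CommRing R] [CommRing S] (φ : R →+* S)
    (A : E → Matrix (Fin 2) (Fin 2) R) : φ (Γ.fExt A) = Γ.fExt fun e => (A e).map φ := by
  have := Fintype.ofFinite Γ.Loop
  rw [fExt, fExt, finprod_eq_prod_of_fintype, finprod_eq_prod_of_fintype, map_prod]
  refine Finset.prod_congr rfl fun γ _ => ?_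
  have htr (B : Matrix (Fin 2) (Fin 2) R) : φ B.trace = (φ.mapMatrix B).trace := by
    simp [Matrix.trace_fin_two]
  rw [htr, map_list_prod, List.map_map]
  congr 3
  ext1 i
  simp only [Function.comp_apply, crossingAdj]
  split_ifs
  · rfl
  · exact RingHom.map_adjugate φ _

theorem exists_eval_eq_fExt :
    ∃ P : MvPolynomial (E × Fin 2 × Fin 2) ℂ, ∀ A : E → Matrix (Fin 2) (Fin 2) ℂ,
      Γ.fExt A = MvPolynomial.eval (fun i => A i.1 i.2.1 i.2.2) P := by
  refine ⟨Γ.fExt fun e => Matrix.of fun i j => MvPolynomial.X (e, i, j), fun A => ?_⟩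
  rw [map_fExt]
  congr 1
  ext e i j
  simp

theorem fExt_smul (c : ℂ) (A : E → Matrix (Fin 2) (Fin 2) ℂ) :
    Γ.fExt (c • A) = c ^ Γ.complexity * Γ.fExt A := by
  have := Fintype.ofFinite Γ.Loop
  rw [fExt, fExt, finprod_eq_prod_of_fintype, finprod_eq_prod_of_fintype, ← sum_minimalPeriod,
    ← Finset.prod_pow_eq_pow_sum, ← Finset.prod_mul_distrib]
  refine Finset.prod_congr rfl fun γ _ => ?_
  have hc (s : Point Γ.num) : Γ.crossingAdj (c • A) s = c • Γ.crossingAdj A s := by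
    simp only [crossingAdj]
    split_ifs
    · rfl
    · simp [Matrix.adjugate_smul]
  have hprod (l : List ℕ) (g : ℕ → Matrix (Fin 2) (Fin 2) ℂ) :
      (l.map fun i => c • g i).prod = c ^ l.length • (l.map g).prod := by
    induction l with
    | nil => simp
    | cons a l ih => simp [ih, smul_smul, pow_succ, mul_comm]
  simp only [hc]
  rw [hprod, Matrix.trace_smul, List.length_range, smul_eq_mul]

/-- The polynomial attached to the chord through which a loop moves after crossing the edge at the
point `s`: up to sign, the determinant of the vectors standing at the two sides that are joined by
the chord. -/
noncomputable def bracket (s : Point Γ.num) : MvPolynomial (Var E) ℂ :=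
  MvPolynomial.C (if (Γ.step s).1.2 then 1 else -1) *
    (MvPolynomial.X ((Γ.cross s).1, 1) * MvPolynomial.X ((Γ.step s).1, 0) -
      MvPolynomial.X ((Γ.cross s).1, 0) * MvPolynomial.X ((Γ.step s).1, 1))

/-- The product over all chords of the determinants of the vectors standing at the two sides. -/
noncomputable def chordPoly : MvPolynomial (Var E) ℂ :=
  ∏ᶠ γ : Γ.Loop, ∏ i ∈ Finset.range (Function.minimalPeriod Γ.step (Quotient.out γ)),
    Γ.bracket (Γ.step^[i] (Quotient.out γ))

theorem fExt_rankOne (z : Var E → ℂ) :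
    Γ.fExt (rankOne z) = MvPolynomial.eval z Γ.chordPoly := by
  have := Fintype.ofFinite Γ.Loop
  rw [fExt, chordPoly, finprod_eq_prod_of_fintype, finprod_eq_prod_of_fintype, map_prod]
  refine Finset.prod_congr rfl fun γ _ => ?_
  rw [map_prod]
  let c (p : E × Bool) : Fin 2 → ℂ :=
    if p.2 then ![-z (p, 1), z (p, 0)] else ![z (p, 1), -z (p, 0)]
  let w (s : Point Γ.num) : Fin 2 → ℂ := fun i => z ((Γ.cross s).1, i)
  have hM (s : Point Γ.num) : Γ.crossingAdj (rankOne z) s = Matrix.vecMulVec (c s.1) (w s) := by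
    rcases s with ⟨⟨e, _ | _⟩, k⟩ <;> ext i j <;> fin_cases i <;> fin_cases j <;>
      simp [crossingAdj, rankOne, c, w, cross, Gluing.opp, Matrix.adjugate_fin_two,
        -Matrix.vecMulVec_cons, -Matrix.cons_vecMulVec, Matrix.vecMulVec_apply, mul_comm]
  simp only [hM]
  rw [trace_prod_vecMulVec (Γ.minimalPeriod_step_pos _) (fun i => c (Γ.step^[i] _).1)
    (fun i => w (Γ.step^[i] _)) (by simp [Function.iterate_minimalPeriod])]
  refine Finset.prod_congr rfl fun i _ => ?_
  rw [Function.iterate_succ_apply']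
  simp only [bracket, c, w, dotProduct, Fin.sum_univ_two]
  split_ifs <;> simp <;> ring

variable [DecidableEq E]

theorem chordPoly_mem_V : Γ.chordPoly ∈ V Γ.num := by
  have := Fintype.ofFinite Γ.Loop
  have hX (p : E × Bool) (i : Fin 2) : MvPolynomial.IsWeightedHomogeneous multidegree
      (MvPolynomial.X (p, i) : MvPolynomial (Var E) ℂ) (Pi.single p 1) :=
    MvPolynomial.isWeightedHomogeneous_X _ _ _
  have hb (s : Point Γ.num) : MvPolynomial.IsWeightedHomogeneous multidegree (Γ.bracket s)
      (Pi.single (Γ.cross s).1 1 + Pi.single (Γ.step s).1 1) :=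
    (Submodule.sub_mem (MvPolynomial.weightedHomogeneousSubmodule ℂ multidegree _)
      ((hX _ _).mul (hX _ _)) ((hX _ _).mul (hX _ _))).C_mul _
  have hP := MvPolynomial.IsWeightedHomogeneous.prod Finset.univ
    (fun γ : Γ.Loop => ∏ i ∈ Finset.range (Function.minimalPeriod Γ.step (Quotient.out γ)),
      Γ.bracket (Γ.step^[i] (Quotient.out γ))) _ fun γ _ =>
    MvPolynomial.IsWeightedHomogeneous.prod _ _ _ fun i _ => hb (Γ.step^[i] (Quotient.out γ))
  rw [← Γ.sum_points_chord fun s => (Pi.single s.1 1 : E × Bool → ℕ)] at hP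
  rw [chordPoly, finprod_eq_prod_of_fintype, MvPolynomial.mem_weightedHomogeneousSubmodule]
  convert hP using 1
  ext p
  rw [Finset.sum_apply, Fintype.sum_sigma]
  simp [Pi.single_apply]

/-- The polynomial `𝐯_Γ` is the product over the chords of the determinants of the vectors
standing at the sides joined by the chord. -/
theorem peterWeylComponent_f :
    (peterWeylComponent Γ.f Γ.num : MvPolynomial (Var E) ℂ) = Γ.chordPoly := by
  obtain ⟨P, hP⟩ := Γ.exists_eval_eq_fExt
  have hf : ∃ x, Upsilon x = Γ.f := by
    obtain ⟨x, hx⟩ := exists_Upsilon_eq_eval P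
    exact ⟨x, by rw [hx]; ext A; rw [f_eq_fExt, hP]⟩
  refine component_eq_of_eval_rankOne (g := Γ.fExt) ?_ (fun c A => Γ.fExt_smul c A) (fun A => ?_)
    Γ.chordPoly_mem_V Γ.fExt_rankOne
  · rw [show Γ.fExt = _ from funext hP]
    exact (MvPolynomial.continuous_eval P).comp (by fun_prop)
  · rw [Function.invFun_eq hf, f_eq_fExt]

theorem G_rankOne (z : Var E → ℂ) : Γ.G (rankOne z) = MvPolynomial.eval z Γ.chordPoly := by
  rw [G, UpsilonExt_rankOne (Subtype.property _), peterWeylComponent_f]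

/-- A lower bound for `G_Γ` on rank one matrices, when the vectors standing at any two sides of a
face have determinants bounded below. -/
theorem le_norm_G_rankOne (z : Var E → ℂ) {μ : E × Bool → ℝ} {κ : ℝ} (hμ : ∀ p, 0 ≤ μ p)
    (hκ : 0 ≤ κ)
    (h : ∀ p q : E × Bool, T.face p = T.face q → p ≠ q →
      κ * (μ p * μ q) ≤ ‖z (p, 1) * z (q, 0) - z (p, 0) * z (q, 1)‖) :
    κ ^ Γ.complexity * ∏ e, (μ (e, true) * μ (e, false)) ^ Γ.num e ≤ ‖Γ.G (rankOne z)‖ := by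
  have := Fintype.ofFinite Γ.Loop
  have hpts : ∏ e, (μ (e, true) * μ (e, false)) ^ Γ.num e = ∏ s : Point Γ.num, μ s.1 := by
    rw [Fintype.prod_sigma, Fintype.prod_prod_type]
    simp [mul_pow]
  rw [G_rankOne, chordPoly, finprod_eq_prod_of_fintype, map_prod, norm_prod, hpts,
    prod_points_chord, ← sum_minimalPeriod, ← Finset.prod_pow_eq_pow_sum,
    ← Finset.prod_mul_distrib]
  have hnn (s : Point Γ.num) : 0 ≤ κ * (μ (Γ.cross s).1 * μ (Γ.step s).1) :=
    mul_nonneg hκ (mul_nonneg (hμ _) (hμ _))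
  refine Finset.prod_le_prod (fun γ _ => ?_) fun γ _ => ?_
  · exact mul_nonneg (pow_nonneg hκ _)
      (Finset.prod_nonneg fun i _ => mul_nonneg (hμ _) (hμ _))
  · rw [map_prod, norm_prod, ← Finset.card_range (Function.minimalPeriod _ _), ← Finset.prod_const,
      Finset.card_range, ← Finset.prod_mul_distrib]
    refine Finset.prod_le_prod (fun i _ => hnn _) fun i _ => ?_
    refine (h _ _ (Γ.chord_face _).symm (Γ.chord_side _).symm).trans (le_of_eq ?_)
    simp only [bracket, map_mul, map_sub, MvPolynomial.eval_X, MvPolynomial.eval_C, norm_mul]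
    split_ifs <;> simp <;> rfl

end Extension
end Lamination

/-! ### Rotations around the rank one matrices -/

section Rotation

open MeasureTheory

/-- The upper right entry of the rank one matrix with the three other entries prescribed. -/
noncomputable def rankOneEntry (a : Fin 2 → Fin 2 → ℂ) : ℂ := a 0 0 * a 1 1 / a 1 0

/-- The rotation of the upper right entry of a matrix around the value for which the matrix has
rank one. -/
noncomputable def rotate (ζ : ℂ) (a : Fin 2 → Fin 2 → ℂ) : Fin 2 → Fin 2 → ℂ :=
  ![![a 0 0, rankOneEntry a + ζ * (a 0 1 - rankOneEntry a)], a 1]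

theorem measurePreserving_rotate {ζ : ℂ} (hζ : ‖ζ‖ = 1) : MeasurePreserving (rotate ζ) := by
  -- a rotation of the complex plane
  have h1 (b : ℂ) : MeasurePreserving (fun y : ℂ => b + ζ * (y - b)) := by
    let u : Circle := ⟨ζ, by simpa [Submonoid.unitSphere] using hζ⟩
    have h := (measurePreserving_add_left volume (b - ζ * b)).comp
      (rotation u).measurePreserving
    have heq : (fun y : ℂ => b + ζ * (y - b)) = (fun x => b - ζ * b + x) ∘ rotation u := by
      funext y
      change b + ζ * (y - b) = b - ζ * b + ζ * y
      ring
    rw [heq]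
    exact h
  -- a shear of the first row
  have h2 (k : ℂ) : MeasurePreserving
      (fun r : Fin 2 → ℂ => (![r 0, r 0 * k + ζ * (r 1 - r 0 * k)] : Fin 2 → ℂ)) := by
    have h : MeasurePreserving (fun p : ℂ × ℂ => (p.1, p.1 * k + ζ * (p.2 - p.1 * k)))
        (volume.prod volume) (volume.prod volume) :=
      (MeasurePreserving.id volume).skew_product
        (g := fun x y : ℂ => x * k + ζ * (y - x * k)) (by fun_prop)
        (Filter.Eventually.of_forall fun x => (h1 (x * k)).map_eq)
    exact ((volume_preserving_finTwoArrow ℂ).symm.comp h).comp (volume_preserving_finTwoArrow ℂ)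
  have h3 : MeasurePreserving (fun p : (Fin 2 → ℂ) × (Fin 2 → ℂ) =>
      (p.1, (![p.2 0, p.2 0 * (p.1 1 / p.1 0) + ζ * (p.2 1 - p.2 0 * (p.1 1 / p.1 0))] :
        Fin 2 → ℂ))) (volume.prod volume) (volume.prod volume) := by
    refine (MeasurePreserving.id volume).skew_product
      (g := fun r s : Fin 2 → ℂ =>
        (![s 0, s 0 * (r 1 / r 0) + ζ * (s 1 - s 0 * (r 1 / r 0))] : Fin 2 → ℂ)) ?_
      (Filter.Eventually.of_forall fun r => (h2 (r 1 / r 0)).map_eq)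
    refine measurable_pi_lambda _ fun i => ?_
    fin_cases i
    · simp [Function.uncurry_def]; fun_prop
    · simp [Function.uncurry_def]; fun_prop
  have h4 := (Measure.measurePreserving_swap (μ := (volume : Measure (Fin 2 → ℂ)))
    (ν := (volume : Measure (Fin 2 → ℂ)))).comp (h3.comp (Measure.measurePreserving_swap
    (μ := (volume : Measure (Fin 2 → ℂ))) (ν := (volume : Measure (Fin 2 → ℂ)))))
  have h5 := ((volume_preserving_finTwoArrow (Fin 2 → ℂ)).symm.comp h4).comp
    (volume_preserving_finTwoArrow (Fin 2 → ℂ))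
  refine Eq.mp (congrArg (fun f => MeasurePreserving f volume volume) ?_) h5
  funext a i j
  fin_cases i
  · fin_cases j <;> simp [rotate, rankOneEntry, MeasurableEquiv.finTwoArrow, mul_div_assoc]
  · simp [rotate, MeasurableEquiv.finTwoArrow]

theorem rankOneEntry_rotate (ζ : ℂ) (a : Fin 2 → Fin 2 → ℂ) :
    rankOneEntry (rotate ζ a) = rankOneEntry a := by
  simp [rankOneEntry, rotate]

theorem det_of {a : Fin 2 → Fin 2 → ℂ} (ha : a 1 0 ≠ 0) :
    (Matrix.of a).det = -(a 1 0 * (a 0 1 - rankOneEntry a)) := by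
  rw [Matrix.det_fin_two, rankOneEntry]
  simp only [Matrix.of_apply]
  field_simp
  ring

theorem norm_det_rotate {ζ : ℂ} (hζ : ‖ζ‖ = 1) {a : Fin 2 → Fin 2 → ℂ} (ha : a 1 0 ≠ 0) :
    ‖(Matrix.of (rotate ζ a)).det‖ = ‖(Matrix.of a).det‖ := by
  rw [det_of ha, det_of (by simpa [rotate] using ha), rankOneEntry_rotate]
  simp [rotate, hζ]

end Rotation

/-! ### The mean value property over roots of unity -/

theorem sum_eval_pow_primitiveRoot {N : ℕ} {ζ : ℂ} (hζ : IsPrimitiveRoot ζ N) {q : Polynomial ℂ}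
    (hq : q.natDegree < N) : ∑ k ∈ Finset.range N, q.eval (ζ ^ k) = N * q.eval 0 := by
  simp_rw [Polynomial.eval_eq_sum_range' hq]
  rw [Finset.sum_comm, ← Polynomial.eval_eq_sum_range' hq, ← Polynomial.coeff_zero_eq_eval_zero,
    Finset.sum_eq_single 0]
  · simp
  · intro i hi hi0
    have h1 : ζ ^ i ≠ 1 := hζ.pow_ne_one_of_pos_of_lt hi0 (Finset.mem_range.1 hi)
    have h2 : ∑ k ∈ Finset.range N, (ζ ^ i) ^ k = 0 := by
      have h := mul_neg_geom_sum (ζ ^ i) N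
      rw [← pow_mul, mul_comm i, pow_mul, hζ.pow_eq_one, one_pow, sub_self] at h
      exact (mul_eq_zero.1 h).resolve_left (sub_ne_zero.2 h1.symm)
    simp_rw [← pow_mul, mul_comm _ i, pow_mul]
    rw [← Finset.mul_sum, h2, mul_zero]
  · intro h
    have : N = 0 := by simpa using h
    omega

theorem le_sum_norm_sq_eval_pow_primitiveRoot {N : ℕ} {ζ : ℂ} (hζ : IsPrimitiveRoot ζ N)
    {q : Polynomial ℂ} (hq : q.natDegree < N) :
    N * ‖q.eval 0‖ ^ 2 ≤ ∑ k ∈ Finset.range N, ‖q.eval (ζ ^ k)‖ ^ 2 := by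
  have hN : (0 : ℝ) < N := by exact_mod_cast (Nat.zero_le _).trans_lt hq
  have h1 : N * ‖q.eval 0‖ ≤ ∑ k ∈ Finset.range N, ‖q.eval (ζ ^ k)‖ := by
    have h := norm_sum_le (Finset.range N) fun k => q.eval (ζ ^ k)
    rwa [sum_eval_pow_primitiveRoot hζ hq, norm_mul, Complex.norm_natCast] at h
  have h2 := sq_sum_le_card_mul_sum_sq (s := Finset.range N) (f := fun k => ‖q.eval (ζ ^ k)‖)
  rw [Finset.card_range] at h2
  have h3 : (N * ‖q.eval 0‖) ^ 2 ≤ (∑ k ∈ Finset.range N, ‖q.eval (ζ ^ k)‖) ^ 2 :=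
    pow_le_pow_left₀ (by positivity) h1 2
  refine le_of_mul_le_mul_left ?_ hN
  linarith

/-! ### A region of nearly rank one matrices -/

section NearRankOne

open MeasureTheory

/-- Matrices close to the rank one matrix `r (-s, 1)ᵀ (1, t)`, except for the upper right entry,
which lies in an annulus around the value that makes the matrix of rank one. -/
def nearRankOne (r s t : ℝ) : Set (Fin 2 → Fin 2 → ℂ) :=
  {a | ‖a 1 0 - r‖ ≤ r / 100 ∧ ‖a 1 1 - r * t‖ ≤ r / 100 ∧ ‖a 0 0 + r * s‖ ≤ r / 100 ∧
    r / 2 ≤ ‖a 0 1 - rankOneEntry a‖ ∧ ‖a 0 1 - rankOneEntry a‖ ≤ r}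

theorem measurableSet_nearRankOne (r s t : ℝ) : MeasurableSet (nearRankOne r s t) := by
  unfold nearRankOne rankOneEntry
  simp only [Set.ofPred_and]
  refine (MeasurableSet.inter ?_ <| .inter ?_ <| .inter ?_ <| .inter ?_ ?_)
  all_goals exact measurableSet_le (by fun_prop) (by fun_prop)

theorem rotate_preimage_nearRankOne {ζ : ℂ} (hζ : ‖ζ‖ = 1) (r s t : ℝ) :
    rotate ζ ⁻¹' nearRankOne r s t = nearRankOne r s t := by
  ext a
  simp only [nearRankOne, Set.mem_preimage, Set.mem_ofPred_eq, rankOneEntry_rotate]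
  simp [rotate, hζ]

theorem le_norm_of_norm_sub_le {r : ℝ} (hr : 0 < r) {p : ℂ} (hp : ‖p - r‖ ≤ r / 100) :
    99 / 100 * r ≤ ‖p‖ := by
  have h := norm_sub_norm_le (r : ℂ) ((r : ℂ) - p)
  rw [sub_sub_cancel, Complex.norm_of_nonneg hr.le, norm_sub_rev] at h
  linarith

theorem le_norm_pivot {r s t : ℝ} (hr : 0 < r) {a : Fin 2 → Fin 2 → ℂ}
    (ha : a ∈ nearRankOne r s t) : 99 / 100 * r ≤ ‖a 1 0‖ :=
  le_norm_of_norm_sub_le hr ha.1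

theorem pivot_ne_zero {r s t : ℝ} (hr : 0 < r) {a : Fin 2 → Fin 2 → ℂ}
    (ha : a ∈ nearRankOne r s t) : a 1 0 ≠ 0 :=
  norm_pos_iff.1 ((by positivity : 0 < 99 / 100 * r).trans_le (le_norm_pivot hr ha))

theorem norm_div_sub_le {r τ : ℝ} (hr : 0 < r) (h0 : 0 ≤ τ) (h2 : τ ≤ 2) {x p : ℂ}
    (hx : ‖x - r * τ‖ ≤ r / 100) (hp : ‖p - r‖ ≤ r / 100) (hp' : 99 / 100 * r ≤ ‖p‖) :
    ‖x / p - τ‖ ≤ 1 / 10 := by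
  have hp0 : 0 < ‖p‖ := (by positivity : 0 < 99 / 100 * r).trans_le hp'
  have hpn : p ≠ 0 := norm_pos_iff.1 hp0
  have h : x / p - τ = ((x - r * τ) - τ * (p - r)) / p := by
    field_simp
    ring
  rw [h, norm_div, div_le_iff₀ hp0]
  calc ‖(x - r * τ) - τ * (p - r)‖ ≤ ‖x - r * τ‖ + ‖(τ : ℂ) * (p - r)‖ := norm_sub_le _ _
    _ ≤ r / 100 + 2 * (r / 100) := by
      rw [norm_mul, Complex.norm_of_nonneg h0]
      gcongr
    _ ≤ 1 / 10 * ‖p‖ := by linarith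

theorem norm_ratio_right_sub_le {r s t : ℝ} (hr : 0 < r) (h0 : 0 ≤ t) (h2 : t ≤ 2)
    {a : Fin 2 → Fin 2 → ℂ} (ha : a ∈ nearRankOne r s t) : ‖a 1 1 / a 1 0 - t‖ ≤ 1 / 10 :=
  norm_div_sub_le hr h0 h2 ha.2.1 ha.1 (le_norm_pivot hr ha)

theorem norm_ratio_left_sub_le {r s t : ℝ} (hr : 0 < r) (h0 : 0 ≤ s) (h2 : s ≤ 2)
    {a : Fin 2 → Fin 2 → ℂ} (ha : a ∈ nearRankOne r s t) : ‖-a 0 0 / a 1 0 - s‖ ≤ 1 / 10 := by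
  refine norm_div_sub_le hr h0 h2 ?_ ha.1 (le_norm_pivot hr ha)
  rw [show -a 0 0 - r * s = -(a 0 0 + r * s) by ring, norm_neg]
  exact ha.2.2.1

theorem sq_le_norm_det {r s t : ℝ} (hr : 0 < r) {a : Fin 2 → Fin 2 → ℂ}
    (ha : a ∈ nearRankOne r s t) : (r / 100) ^ 2 ≤ ‖(Matrix.of a).det‖ := by
  rw [det_of (pivot_ne_zero hr ha), norm_neg, norm_mul]
  calc (r / 100) ^ 2 ≤ (99 / 100 * r) * (r / 2) := by nlinarith
    _ ≤ _ := mul_le_mul (le_norm_pivot hr ha) ha.2.2.2.1 (by positivity) (norm_nonneg _)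

theorem trace_mul_conjTranspose (a : Fin 2 → Fin 2 → ℂ) :
    (Matrix.trace (Matrix.of a * (Matrix.of a)ᴴ)).re =
      ‖a 0 0‖ ^ 2 + ‖a 0 1‖ ^ 2 + ‖a 1 0‖ ^ 2 + ‖a 1 1‖ ^ 2 := by
  simp [Matrix.trace_fin_two, Matrix.mul_apply, Complex.sq_norm, Complex.normSq_apply]
  ring

theorem trace_lt_of_mem_nearRankOne {r s t : ℝ} (hr : 0 < r) (hs0 : 0 ≤ s) (hs2 : s ≤ 2)
    (ht0 : 0 ≤ t) (ht2 : t ≤ 2) {a : Fin 2 → Fin 2 → ℂ} (ha : a ∈ nearRankOne r s t) :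
    (Matrix.trace (Matrix.of a * (Matrix.of a)ᴴ)).re < (10 * r) ^ 2 := by
  have key {x : ℂ} {c : ℝ} {τ : ℝ} (hτ0 : 0 ≤ τ) (h : ‖x - c‖ ≤ r / 100) (hc : |c| = r * τ) :
      ‖x‖ ≤ r * τ + r / 100 := by
    have h' := norm_add_le (x - c) (c : ℂ)
    rw [sub_add_cancel, Complex.norm_real, Real.norm_eq_abs, hc] at h'
    linarith
  have h10 : ‖a 1 0‖ ≤ 2 * r := by
    have := key (c := r) zero_le_one ha.1 (by rw [abs_of_pos hr, mul_one])
    linarith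
  have h11 : ‖a 1 1‖ ≤ 201 / 100 * r := by
    have := key (c := r * t) ht0 (by simpa using ha.2.1) (abs_of_nonneg (by positivity))
    nlinarith
  have h00 : ‖a 0 0‖ ≤ 201 / 100 * r := by
    have := key (c := -(r * s)) hs0 (by simpa using ha.2.2.1)
      (by rw [abs_neg, abs_of_nonneg (by positivity)])
    nlinarith
  have hp := le_norm_pivot hr ha
  have hc : ‖rankOneEntry a‖ ≤ 5 * r := by
    rw [rankOneEntry, norm_div, norm_mul, div_le_iff₀ (by linarith [hr])]
    calc ‖a 0 0‖ * ‖a 1 1‖ ≤ (201 / 100 * r) * (201 / 100 * r) := by gcongr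
      _ ≤ 5 * r * (99 / 100 * r) := by nlinarith
      _ ≤ 5 * r * ‖a 1 0‖ := by gcongr
  have h01 : ‖a 0 1‖ ≤ 6 * r := by
    have h := norm_add_le (a 0 1 - rankOneEntry a) (rankOneEntry a)
    rw [sub_add_cancel] at h
    linarith [ha.2.2.2.2]
  rw [trace_mul_conjTranspose]
  have e1 : ‖a 0 0‖ ^ 2 ≤ (201 / 100 * r) ^ 2 := by gcongr
  have e2 : ‖a 0 1‖ ^ 2 ≤ (6 * r) ^ 2 := by gcongr
  have e3 : ‖a 1 0‖ ^ 2 ≤ (2 * r) ^ 2 := by gcongr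
  have e4 : ‖a 1 1‖ ^ 2 ≤ (201 / 100 * r) ^ 2 := by gcongr
  nlinarith

theorem volume_ball_ge {c : ℂ} {r : ℝ} : ENNReal.ofReal r ^ 2 ≤ volume (Metric.ball c r) := by
  rw [Complex.volume_ball]
  refine le_mul_of_one_le_right (zero_le) ?_
  have : (1 : NNReal) ≤ NNReal.pi := by
    rw [← NNReal.coe_le_coe]
    simpa using (by linarith [Real.pi_gt_three] : (1 : ℝ) ≤ Real.pi)
  exact_mod_cast this

theorem le_volume_nearRankOne {r s t : ℝ} (hr : 0 < r) (hs0 : 0 ≤ s) (hs2 : s ≤ 2)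
    (ht0 : 0 ≤ t) (ht2 : t ≤ 2) :
    ENNReal.ofReal (r / 100) ^ 8 ≤ volume (nearRankOne r s t) := by
  -- a product of four discs of radius `r / 100`
  let c : Fin 2 → Fin 2 → ℂ := ![![-(r * s), -(r * s * t) + 3 / 4 * r], ![r, r * t]]
  have hsub : (Set.univ.pi fun i => Set.univ.pi fun j => Metric.ball (c i j) (r / 100)) ⊆
      nearRankOne r s t := by
    intro a ha
    have hm (i j : Fin 2) : ‖a i j - c i j‖ < r / 100 := by
      simpa [dist_eq_norm] using ha i (Set.mem_univ _) j (Set.mem_univ _)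
    have h00 : ‖a 0 0 + r * s‖ ≤ r / 100 := by simpa [c] using (hm 0 0).le
    have h01 : ‖a 0 1 - (-(r * s * t) + 3 / 4 * r)‖ ≤ r / 100 := by simpa [c] using (hm 0 1).le
    have h10 : ‖a 1 0 - r‖ ≤ r / 100 := by simpa [c] using (hm 1 0).le
    have h11 : ‖a 1 1 - r * t‖ ≤ r / 100 := by simpa [c] using (hm 1 1).le
    have hp : 99 / 100 * r ≤ ‖a 1 0‖ := le_norm_of_norm_sub_le hr h10
    have hp0 : a 1 0 ≠ 0 := norm_pos_iff.1 ((by positivity : 0 < 99 / 100 * r).trans_le hp)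
    have hc : ‖rankOneEntry a + r * s * t‖ ≤ r / 10 := by
      have h : rankOneEntry a + r * s * t = ((a 0 0 + r * s) * (r * t) -
          (r * s) * (a 1 1 - r * t) + (a 0 0 + r * s) * (a 1 1 - r * t) +
          (r * s * t) * (a 1 0 - r)) / a 1 0 := by
        rw [rankOneEntry]
        field_simp
        ring
      have hrt : ‖(r * t : ℂ)‖ ≤ r * 2 := by
        rw [← Complex.ofReal_mul, Complex.norm_of_nonneg (by positivity)]
        gcongr
      have hrs : ‖(r * s : ℂ)‖ ≤ r * 2 := by
        rw [← Complex.ofReal_mul, Complex.norm_of_nonneg (by positivity)]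
        gcongr
      have hrst : ‖(r * s * t : ℂ)‖ ≤ r * 2 * 2 := by
        rw [← Complex.ofReal_mul, ← Complex.ofReal_mul, Complex.norm_of_nonneg (by positivity)]
        gcongr
      rw [h, norm_div, div_le_iff₀ (norm_pos_iff.2 hp0)]
      calc _ ≤ ‖a 0 0 + r * s‖ * ‖(r * t : ℂ)‖ + ‖(r * s : ℂ)‖ * ‖a 1 1 - r * t‖ +
            ‖a 0 0 + r * s‖ * ‖a 1 1 - r * t‖ + ‖(r * s * t : ℂ)‖ * ‖a 1 0 - r‖ := by
            rw [← norm_mul, ← norm_mul, ← norm_mul, ← norm_mul]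
            refine (norm_add_le _ _).trans (add_le_add_left ?_ _)
            refine (norm_add_le _ _).trans (add_le_add_left ?_ _)
            exact norm_sub_le _ _
        _ ≤ r / 100 * (r * 2) + r * 2 * (r / 100) + r / 100 * (r / 100) +
            r * 2 * 2 * (r / 100) := by gcongr
        _ ≤ r / 10 * (99 / 100 * r) := by nlinarith
        _ ≤ r / 10 * ‖a 1 0‖ := by gcongr
    have h : a 0 1 - rankOneEntry a = (a 0 1 - (-(r * s * t) + 3 / 4 * r)) -
        (rankOneEntry a + r * s * t) + (3 / 4 * r : ℝ) := by
      push_cast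
      ring
    have h' : ‖(a 0 1 - (-(r * s * t) + 3 / 4 * r)) - (rankOneEntry a + r * s * t)‖ ≤
        r / 100 + r / 10 := (norm_sub_le _ _).trans (add_le_add h01 hc)
    have h34 : ‖((3 / 4 * r : ℝ) : ℂ)‖ = 3 / 4 * r := Complex.norm_of_nonneg (by positivity)
    refine ⟨h10, h11, h00, ?_, ?_⟩
    · have := norm_sub_norm_le ((3 / 4 * r : ℝ) : ℂ)
        (-((a 0 1 - (-(r * s * t) + 3 / 4 * r)) - (rankOneEntry a + r * s * t)))
      rw [sub_neg_eq_add, add_comm ((3 / 4 * r : ℝ) : ℂ), ← h, norm_neg, h34] at this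
      linarith
    · rw [h]
      refine (norm_add_le _ _).trans ?_
      rw [h34]
      linarith
  refine le_trans ?_ (measure_mono hsub)
  rw [volume_pi_pi]
  simp_rw [volume_pi_pi]
  calc ENNReal.ofReal (r / 100) ^ 8 =
        ∏ _i : Fin 2, ∏ _j : Fin 2, ENNReal.ofReal (r / 100) ^ 2 := by
        simp only [Finset.prod_const, Finset.card_univ, Fintype.card_fin, ← pow_mul]
    _ ≤ _ := Finset.prod_le_prod' fun i _ => Finset.prod_le_prod' fun j _ => volume_ball_ge

end NearRankOne

section GoodRegion

open MeasureTheory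

variable {E F : Type}

/-- A product of regions of nearly rank one matrices: the vectors standing at the sides of every
face are close to multiples of `(1, 0)`, `(1, 1)`, `(1, 2)`, and in particular they are pairwise
transversal. -/
def goodRegion (T : Gluing E F) (r : ℝ) : Set (E → Fin 2 → Fin 2 → ℂ) :=
  Set.univ.pi fun e => nearRankOne r ((T.side (e, true)).2 : ℕ) ((T.side (e, false)).2 : ℕ)

theorem side_index_le_two (T : Gluing E F) (p : E × Bool) : (((T.side p).2 : ℕ) : ℝ) ≤ 2 := by
  exact_mod_cast Nat.lt_succ_iff.1 (T.side p).2.2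

theorem goodRegion_subset_polyBall (T : Gluing E F) {r : ℝ} (hr : 0 < r) :
    goodRegion T r ⊆ polyBall E (10 * r) := fun _ ha e =>
  trace_lt_of_mem_nearRankOne hr (Nat.cast_nonneg _) (side_index_le_two T _) (Nat.cast_nonneg _)
    (side_index_le_two T _) (ha e (Set.mem_univ e))

variable [Fintype E]

theorem polyBall_subset_closedBall (R : ℝ) (hR : 0 < R) :
    polyBall E R ⊆ Metric.closedBall 0 R := by
  intro a ha
  rw [mem_closedBall_zero_iff]
  refine (pi_norm_le_iff_of_nonneg hR.le).2 fun e => (pi_norm_le_iff_of_nonneg hR.le).2 fun i =>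
    (pi_norm_le_iff_of_nonneg hR.le).2 fun j => ?_
  have h := ha e
  rw [trace_mul_conjTranspose] at h
  refine le_of_lt (lt_of_pow_lt_pow_left₀ 2 hR.le (lt_of_le_of_lt ?_ h))
  have := sq_nonneg ‖a e 0 0‖
  have := sq_nonneg ‖a e 0 1‖
  have := sq_nonneg ‖a e 1 0‖
  have := sq_nonneg ‖a e 1 1‖
  fin_cases i <;> fin_cases j <;> simp <;> linarith

theorem le_volume_goodRegion (T : Gluing E F) {r : ℝ} (hr : 0 < r)
    (hfin : volume (goodRegion T r) ≠ ⊤) :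
    (r / 100) ^ (8 * Fintype.card E) ≤ volume.real (goodRegion T r) := by
  rw [measureReal_def, ← ENNReal.ofReal_le_iff_le_toReal hfin, goodRegion, volume_pi_pi,
    pow_mul, ENNReal.ofReal_pow (by positivity), ENNReal.ofReal_pow (by positivity)]
  rw [← Finset.card_univ, ← Finset.prod_const]
  exact Finset.prod_le_prod' fun e _ => le_volume_nearRankOne hr (Nat.cast_nonneg _)
    (side_index_le_two T _) (Nat.cast_nonneg _) (side_index_le_two T _)

end GoodRegion

/-! ### The lower bound -/

section LowerBound

open MeasureTheory

theorem exists_polynomial_eval_rotate {E : Type} (P : MvPolynomial (E × Fin 2 × Fin 2) ℂ)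
    (a : E → Fin 2 → Fin 2 → ℂ) :
    ∃ q : Polynomial ℂ, q.natDegree ≤ P.totalDegree ∧ ∀ ζ : ℂ,
      q.eval ζ = MvPolynomial.eval (fun i => rotate ζ (a i.1) i.2.1 i.2.2) P := by
  let ℓ (i : E × Fin 2 × Fin 2) : Polynomial ℂ :=
    (![![Polynomial.C (a i.1 0 0),
        Polynomial.C (a i.1 0 1 - rankOneEntry (a i.1)) * Polynomial.X +
          Polynomial.C (rankOneEntry (a i.1))],
      fun j => Polynomial.C (a i.1 1 j)] : Fin 2 → Fin 2 → Polynomial ℂ) i.2.1 i.2.2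
  refine ⟨MvPolynomial.aeval ℓ P, ?_, fun ζ => ?_⟩
  · refine (MvPolynomial.aeval_natDegree_le P le_rfl ℓ (n := 1) fun i => ?_).trans (mul_one _).le
    rcases i with ⟨e, i, j⟩
    fin_cases i
    · fin_cases j
      · simp [ℓ]
      · exact Polynomial.natDegree_linear_le
    · simp [ℓ]
  · rw [← Polynomial.coe_evalRingHom, MvPolynomial.aeval_def, MvPolynomial.hom_eval₂]
    rw [← MvPolynomial.eval₂_id]
    congr 1
    · ext x
      simp
    · funext i
      rcases i with ⟨e, i, j⟩
      fin_cases i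
      · fin_cases j
        · simp [ℓ, rotate]
        · simp [ℓ, rotate]
          ring
      · simp [ℓ, rotate]

namespace Lamination

variable {E F : Type} [Fintype E] [DecidableEq E] {T : Gluing E F} (Γ : Lamination T)

/-- The lower bound for `G_Γ` at the rank one matrices that are the centers of the rotations. -/
theorem le_norm_G_rotate_zero {r : ℝ} (hr : 0 < r) {a : E → Fin 2 → Fin 2 → ℂ}
    (ha : a ∈ goodRegion T r) :
    (r / 100) ^ Γ.complexity ≤ ‖Γ.G fun e => Matrix.of (rotate 0 (a e))‖ := by
  have ha' (e : E) := ha e (Set.mem_univ e)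
  let lam (p : E × Bool) : ℂ := if p.2 then 1 else a p.1 1 0
  let ρ (p : E × Bool) : ℂ := if p.2 then -a p.1 0 0 / a p.1 1 0 else a p.1 1 1 / a p.1 1 0
  let τ (p : E × Bool) : ℝ := ((T.side p).2 : ℕ)
  let μ (p : E × Bool) : ℝ := if p.2 then 1 else 99 / 100 * r
  let z (v : Var E) : ℂ := if v.2 = 0 then lam v.1 else lam v.1 * ρ v.1
  have hz : (fun e => Matrix.of (rotate 0 (a e))) = rankOne z := by
    funext e
    have hp := pivot_ne_zero hr (ha' e)
    ext i j
    rw [rankOne, Matrix.vecMulVec_apply]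
    fin_cases i <;> fin_cases j <;> simp [rotate, rankOneEntry, z, lam, ρ] <;> field_simp
  have hρ (p : E × Bool) : ‖ρ p - τ p‖ ≤ 1 / 10 := by
    rcases p with ⟨e, _ | _⟩
    · exact norm_ratio_right_sub_le hr (Nat.cast_nonneg _) (side_index_le_two T _) (ha' e)
    · exact norm_ratio_left_sub_le hr (Nat.cast_nonneg _) (side_index_le_two T _) (ha' e)
  have hμ (p : E × Bool) : 0 ≤ μ p ∧ μ p ≤ ‖lam p‖ := by
    rcases p with ⟨e, _ | _⟩
    · exact ⟨by simp only [μ]; positivity, le_norm_pivot hr (ha' e)⟩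
    · simp [μ, lam]
  have h := Γ.le_norm_G_rankOne z (μ := μ) (κ := 1 / 2) (fun p => (hμ p).1) (by norm_num) ?_
  · rw [hz]
    refine le_trans ?_ h
    have hprod : ∏ e, (μ (e, true) * μ (e, false)) ^ Γ.num e = (99 / 100 * r) ^ Γ.complexity := by
      simp [μ, complexity, Finset.prod_pow_eq_pow_sum]
    rw [hprod, ← mul_pow]
    exact pow_le_pow_left₀ (by positivity) (by linarith) _
  · intro p q hpq hne
    have hτ : 1 ≤ ‖(τ p - τ q : ℂ)‖ := by
      have hidx : ((T.side p).2 : ℕ) ≠ (T.side q).2 := fun h =>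
        hne (T.side.injective (Prod.ext hpq (Fin.ext h)))
      have : (1 : ℤ) ≤ |(((T.side p).2 : ℕ) : ℤ) - ((T.side q).2 : ℕ)| :=
        Int.one_le_abs (sub_ne_zero.2 (by exact_mod_cast hidx))
      rw [← Complex.ofReal_sub, Complex.norm_real, Real.norm_eq_abs]
      simp only [τ]
      exact_mod_cast this
    have hρpq : 1 / 2 ≤ ‖ρ p - ρ q‖ := by
      have h1 : (τ p - τ q : ℂ) = (ρ p - ρ q) - (ρ p - τ p) + (ρ q - τ q) := by ring
      have h2 := norm_add_le ((ρ p - ρ q) - (ρ p - τ p)) (ρ q - τ q)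
      have h3 := norm_sub_le (ρ p - ρ q) (ρ p - τ p)
      rw [← h1] at h2
      linarith [hρ p, hρ q]
    have h4 : z (p, 1) * z (q, 0) - z (p, 0) * z (q, 1) = (ρ p - ρ q) * (lam p * lam q) := by
      simp [z]
      ring
    rw [h4, norm_mul, norm_mul]
    exact mul_le_mul hρpq (mul_le_mul (hμ p).2 (hμ q).2 (hμ q).1 (norm_nonneg _))
      (mul_nonneg (hμ p).1 (hμ q).1) (norm_nonneg _)

/-- The average of `|G_{Γ,𝐦}|²` over rotations around the rank one matrices. -/
theorem le_sum_norm_sq_Gm_rotate (m : E → ℕ) {r : ℝ} (hr : 0 < r) {a : E → Fin 2 → Fin 2 → ℂ}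
    (ha : a ∈ goodRegion T r) {P : MvPolynomial (E × Fin 2 × Fin 2) ℂ}
    (hP : ∀ A : E → Matrix (Fin 2) (Fin 2) ℂ,
      Γ.G A = MvPolynomial.eval (fun i => A i.1 i.2.1 i.2.2) P)
    {N : ℕ} (hN : P.totalDegree < N) {ζ : ℂ} (hζ : IsPrimitiveRoot ζ N) :
    N * ((r / 100) ^ (Γ.complexity + 2 * ∑ e, m e)) ^ 2 ≤
      ∑ k ∈ Finset.range N, ‖Γ.Gm m fun e => Matrix.of (rotate (ζ ^ k) (a e))‖ ^ 2 := by
  have ha' (e : E) := ha e (Set.mem_univ e)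
  have hζ1 : ‖ζ‖ = 1 := hζ.norm'_eq_one (by omega)
  obtain ⟨q, hq, hqe⟩ := exists_polynomial_eval_rotate P a
  have hqG (ζ : ℂ) : q.eval ζ = Γ.G fun e => Matrix.of (rotate ζ (a e)) := by
    rw [hqe, hP]
    rfl
  have hmean := le_sum_norm_sq_eval_pow_primitiveRoot hζ (hq.trans_lt hN)
  simp only [hqG] at hmean
  have hG0 := Γ.le_norm_G_rotate_zero hr ha
  have hdet : (r / 100) ^ (2 * ∑ e, m e) ≤ ∏ e, ‖(Matrix.of (a e)).det‖ ^ m e := by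
    rw [pow_mul, ← Finset.prod_pow_eq_pow_sum]
    exact Finset.prod_le_prod (fun e _ => by positivity) fun e _ =>
      pow_le_pow_left₀ (by positivity) (sq_le_norm_det hr (ha' e)) _
  have hGm (k : ℕ) : ‖Γ.Gm m fun e => Matrix.of (rotate (ζ ^ k) (a e))‖ ^ 2 =
      ‖Γ.G fun e => Matrix.of (rotate (ζ ^ k) (a e))‖ ^ 2 *
        (∏ e, ‖(Matrix.of (a e)).det‖ ^ m e) ^ 2 := by
    rw [Gm, norm_mul, norm_prod, mul_pow]
    congr 3
    funext e
    rw [norm_pow, norm_det_rotate (by rw [norm_pow, hζ1, one_pow]) (pivot_ne_zero hr (ha' e))]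
  calc N * ((r / 100) ^ (Γ.complexity + 2 * ∑ e, m e)) ^ 2
      = N * ((r / 100) ^ Γ.complexity) ^ 2 * ((r / 100) ^ (2 * ∑ e, m e)) ^ 2 := by
        rw [pow_add, mul_pow, mul_assoc]
    _ ≤ N * ‖Γ.G fun e => Matrix.of (rotate 0 (a e))‖ ^ 2 *
          (∏ e, ‖(Matrix.of (a e)).det‖ ^ m e) ^ 2 := by gcongr
    _ ≤ (∑ k ∈ Finset.range N, ‖Γ.G fun e => Matrix.of (rotate (ζ ^ k) (a e))‖ ^ 2) *
          (∏ e, ‖(Matrix.of (a e)).det‖ ^ m e) ^ 2 :=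
        mul_le_mul_of_nonneg_right hmean (sq_nonneg _)
    _ = _ := by rw [Finset.sum_mul]; exact Finset.sum_congr rfl fun k _ => (hGm k).symm

theorem le_polyBallNorm_Gm (m : E → ℕ) {r : ℝ} (hr : 0 < r) :
    (r / 100) ^ (Γ.complexity + 2 * (∑ e, m e) + 4 * Fintype.card E) ≤
      polyBallNorm (10 * r) (Γ.Gm m) := by
  obtain ⟨P, hP⟩ := exists_eval_eq_UpsilonExt
    (peterWeylComponent Γ.f Γ.num : MvPolynomial (Var E) ℂ)
  have hGc : Continuous Γ.G := continuous_UpsilonExt _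
  let H (a : E → Fin 2 → Fin 2 → ℂ) : ℝ := ‖Γ.Gm m fun e => Matrix.of (a e)‖ ^ 2
  have hH : Continuous H := by
    have h1 : Continuous fun a : E → Fin 2 → Fin 2 → ℂ => fun e => Matrix.of (a e) := by
      exact continuous_id
    have h2 : Continuous (Γ.Gm m) := by
      unfold Gm
      fun_prop
    exact (h2.comp h1).norm.pow 2
  have : IsLocallyFiniteMeasure (volume : Measure (E → Fin 2 → Fin 2 → ℂ)) :=
    Measure.pi.isLocallyFiniteMeasure
  have hball : volume (polyBall E (10 * r)) < ⊤ :=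
    (measure_mono (polyBall_subset_closedBall _ (by positivity))).trans_lt
      measure_closedBall_lt_top
  have hint : IntegrableOn H (polyBall E (10 * r)) :=
    (hH.continuousOn.integrableOn_compact (isCompact_closedBall 0 (10 * r))).mono_set
      (polyBall_subset_closedBall _ (by positivity))
  set W := goodRegion T r with hW
  have hWsub := goodRegion_subset_polyBall T hr
  have hWfin : volume W ≠ ⊤ := ((measure_mono hWsub).trans_lt hball).ne
  have hWm : MeasurableSet W := MeasurableSet.univ_pi fun e => measurableSet_nearRankOne _ _ _
  have hintW : IntegrableOn H W := hint.mono_set hWsub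
  obtain ⟨N, hN⟩ : ∃ N, P.totalDegree < N := ⟨_, Nat.lt_succ_self _⟩
  have hN0 : N ≠ 0 := by omega
  have hζ := Complex.isPrimitiveRoot_exp N hN0
  set ζ := Complex.exp (2 * Real.pi * Complex.I / N)
  have hζ1 (k : ℕ) : ‖ζ ^ k‖ = 1 := by rw [norm_pow, hζ.norm'_eq_one hN0, one_pow]
  have hrot (k : ℕ) : MeasurePreserving
      (fun (a : E → Fin 2 → Fin 2 → ℂ) e => rotate (ζ ^ k) (a e))
      (volume.restrict W) (volume.restrict W) := by
    have hpre : (fun (a : E → Fin 2 → Fin 2 → ℂ) e => rotate (ζ ^ k) (a e)) ⁻¹' W = W := by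
      ext a
      refine forall_congr' fun e => forall_congr' fun _ => ?_
      exact Set.ext_iff.1 (rotate_preimage_nearRankOne (hζ1 k) _ _ _) (a e)
    have h := (volume_preserving_pi fun _ : E => measurePreserving_rotate (hζ1 k)).restrict_preimage
      hWm
    rwa [hpre] at h
  have hk (k : ℕ) : ∫ a in W, H (fun e => rotate (ζ ^ k) (a e)) = ∫ a in W, H a := by
    conv_rhs => rw [← (hrot k).map_eq]
    rw [integral_map (hrot k).aemeasurable hH.aestronglyMeasurable]
  have hki (k : ℕ) : IntegrableOn (fun a => H fun e => rotate (ζ ^ k) (a e)) W :=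
    (hrot k).integrable_comp_of_integrable hintW
  have hsum : ∫ a in W, ∑ k ∈ Finset.range N, H (fun e => rotate (ζ ^ k) (a e)) =
      N * ∫ a in W, H a := by
    rw [integral_finsetSum _ fun k _ => hki k]
    simp [hk]
  have hlow := setIntegral_ge_of_const_le_real hWm hWfin
    (fun a ha => Γ.le_sum_norm_sq_Gm_rotate m hr ha hP hN hζ)
    (integrable_finsetSum _ fun k _ => hki k)
  rw [hsum, mul_assoc] at hlow
  have hlow' := le_of_mul_le_mul_left hlow (by exact_mod_cast Nat.pos_of_ne_zero hN0)
  have hmono : ∫ a in W, H a ≤ ∫ a in polyBall E (10 * r), H a :=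
    setIntegral_mono_set hint (Filter.Eventually.of_forall fun a => by positivity)
      (Filter.Eventually.of_forall hWsub)
  refine Real.le_sqrt_of_sq_le (le_trans (le_of_eq ?_) ((mul_le_mul_of_nonneg_left
    (le_volume_goodRegion T hr hWfin) (by positivity)).trans (hlow'.trans hmono)))
  ring

end Lamination
end LowerBound
end PeterWeyl

theorem proposition3p13 :
    ∃ η₀ : ℝ, 0 < η₀ ∧
      ∀ (E F : Type) [Fintype E] [DecidableEq E] [Fintype F]
        (T : PeterWeyl.Triangulation E F) (Γ : PeterWeyl.Lamination T.toGluing)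
        (m : E → ℕ) (R : ℝ), 0 < R →
        (η₀ * R) ^ (Γ.complexity + 2 * (∑ e, m e) + 4 * Fintype.card E) ≤
          PeterWeyl.polyBallNorm R (Γ.Gm m) := by
  refine ⟨1 / 1000, by norm_num, fun E F _ _ _ T Γ m R hR => ?_⟩
  have h := Γ.le_polyBallNorm_Gm m (r := R / 10) (by positivity)
  rw [mul_div_cancel₀ R (by norm_num : (10 : ℝ) ≠ 0)] at h
  convert h using 2
  ring
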